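/- Let $k$ be a natural number, let $F$ and $G$ be convex sets in $\mathbb{R}^k$ that are symmetric about the origin ($F=-F$, $G=-G$), and let $A$ and $C$ be fixed (symmetric) positive definite real $k\times k$ matrices. For a real $k\times k$ matrix $B$ such that the block matrix $\begin{pmatrix} A & B\\ B^T & C\end{pmatrix}$ is positive definite (this holds for all $B$ in a neighbourhood of $0$ in $\mathbb{R}^{k\times k}$), let $\mu_B$ be the non-singular centered Gaussian probability measure on $\mathbb{R}^{2k}=\mathbb{R}^k\times\mathbb{R}^k$ with this covariance matrix. Then the function $B\mapsto\mu_B(F\times G)$ has a local minimum at $B=0$; that is, $\mu_B(F\times G)\ge\mu_0(F\times G)$ for all $B$ in some neighbourhood of $0$ in $\mathbb{R}^{k\times k}$. -/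

import Mathlib

open MeasureTheory ProbabilityTheory

noncomputable section

/-- The product set `F × G`, viewed inside `ℝ^{2k}`, whose coordinates are indexed by
`Fin k ⊕ Fin k`: the points whose first `k` coordinates form a point of `F` and whose last `k`
coordinates form a point of `G`. -/
def prodSet {k : ℕ} (F G : Set (EuclideanSpace ℝ (Fin k))) :
    Set (EuclideanSpace ℝ (Fin k ⊕ Fin k)) :=
  {z | WithLp.toLp 2 (fun i => z (Sum.inl i)) ∈ F ∧ WithLp.toLp 2 (fun j => z (Sum.inr j)) ∈ G}

/-- The centered Gaussian measure `μ_B` on `ℝ^{2k}` with covariance matrix `[[A, B], [Bᵀ, C]]`.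
It is the intended (non-singular) measure whenever that matrix is positive definite; when `A` and
`C` are positive definite this holds for all `B` in a neighbourhood of `0`. -/
def blockGaussian {k : ℕ} (A C B : Matrix (Fin k) (Fin k) ℝ) :
    Measure (EuclideanSpace ℝ (Fin k ⊕ Fin k)) :=
  multivariateGaussian 0 (Matrix.fromBlocks A B B.transpose C)

end

/-!
Write `γ` for the standard Gaussian measure. A linear change of coordinates reduces the statement
to `A = C = 1`, and since the frontier of a convex set is null, `F` and `G` may be replaced by
their closures. Put `φ(B) = μ_B(F × G)`.

*Second-order expansion.* With `K = [[0, B], [Bᵀ, 0]]` and `N = (1 - K²)⁻¹`, the density of `μ_B`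
with respect to `γ` is `det(1 + K)^(-1/2) exp(-a + b)`, where `a(z) = ⟪z, (N - 1) z⟫ / 2` is even
and `b(z) = ⟪z, N K z⟫ / 2` is odd in `B`. As `F = -F`, `φ(B) = φ(-B)`, so `φ(B)` is the integral
of `det(1 + K)^(-1/2) exp(-a) cosh b` over `F × G`. The elementary bounds
`det(1 + K) ≤ exp(-‖B‖²)`, `exp u ≥ 1 + u` and `cosh b ≥ 1 + b² / 2` (Frobenius norm) give
`φ(B) - φ(0) ≥ tr(S_F B S_G Bᵀ) / 2 - O(‖B‖⁴)` with `S_F = ∫_F (1 - x xᵀ) dγ(x)`; see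
`le_blockGaussian_real_prodSet` and `setIntegral_quadDensity`. No upper bound on the density is
needed.

*The Hessian is positive semidefinite.* For a unit vector `v`, let `h(t)` be the Gaussian measure
of the slice of `F` at height `t` in the direction `v`. By the Prékopa–Leindler inequality and the
symmetry of `F`, `h` is even and antitone in `|t|`. As `1 - t²` has mean zero under the normal law,
`vᵀ S_F v = ∫ (1 - t²) (h(t) - h(1))`, and the integrand is nonnegative.

*The degenerate directions.* If `S_F v = 0`, then `h` is almost everywhere constant, so the slices
of `F` far out along `v` keep a fixed positive mass. When `F` is closed and has positive measure,
this makes `v` a direction of recession, and `F` is invariant under translation by `v`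
(`add_mem_of_momentDefect_mulVec_eq_zero`). Let `P` and `Q` be idempotent matrices with the
kernels of `S_F` and `S_G`. Then `φ(B) = φ(P B Qᵀ)`, and on the space of matrices with
`P B Qᵀ = B` the form `tr(S_F B S_G Bᵀ)` is positive definite (`exists_coercive`), so that it
dominates the error `O(‖B‖⁴)` near `0`.
-/

open scoped ENNReal Pointwise RealInnerProductSpace Topology MatrixOrder
open Filter Matrix

/-! ### The Prékopa–Leindler inequality for Gaussian measures -/

/-- The translates `min L + K` and `max K + L` both lie in `K + L` and meet in at most one point. -/
theorem volume_add_volume_le_of_isCompact {K L C : Set ℝ} (hK : IsCompact K) (hL : IsCompact L)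
    (hK0 : K.Nonempty) (hL0 : L.Nonempty) (hC : K + L ⊆ C) :
    volume K + volume L ≤ volume C := by
  have hk := hK.sSup_mem hK0
  have hl := hL.sInf_mem hL0
  set k := sSup K
  set l := sInf L
  have h1 : (fun x => l + x) '' K ∪ (fun x => k + x) '' L ⊆ C := by
    rintro _ (⟨x, hx, rfl⟩ | ⟨x, hx, rfl⟩)
    · exact hC ⟨x, hx, l, hl, add_comm _ _⟩
    · exact hC ⟨k, hk, x, hx, rfl⟩
  have h2 : (fun x => l + x) '' K ∩ (fun x => k + x) '' L ⊆ {l + k} := by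
    rintro _ ⟨⟨x, hx, rfl⟩, y, hy, hxy⟩
    have := le_csSup hK.bddAbove hx
    have := csInf_le hL.bddBelow hy
    simp only [Set.mem_singleton_iff] at *
    linarith
  have h3 : AEDisjoint volume ((fun x => l + x) '' K) ((fun x => k + x) '' L) :=
    measure_mono_null h2 (by simp)
  have hm : NullMeasurableSet ((fun x => k + x) '' L) volume :=
    (hL.image (by fun_prop)).measurableSet.nullMeasurableSet
  calc volume K + volume L
      = volume ((fun x => l + x) '' K) + volume ((fun x => k + x) '' L) := by
        simp [Set.image_add_left, measure_preimage_add]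
    _ = volume ((fun x => l + x) '' K ∪ (fun x => k + x) '' L) := (measure_union₀ hm h3).symm
    _ ≤ volume C := measure_mono h1

/-- The Brunn–Minkowski inequality on the real line. -/
theorem volume_add_volume_le {A B C : Set ℝ} (hA : MeasurableSet A) (hB : MeasurableSet B)
    (hA0 : A.Nonempty) (hB0 : B.Nonempty) (hC : A + B ⊆ C) :
    volume A + volume B ≤ volume C := by
  obtain ⟨a, ha⟩ := hA0
  obtain ⟨b, hb⟩ := hB0
  rw [hA.measure_eq_iSup_isCompact, hB.measure_eq_iSup_isCompact]
  simp only [iSup_and']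
  refine ENNReal.biSup_add_biSup_le' (p := fun K => K ⊆ A ∧ IsCompact K)
    (q := fun L => L ⊆ B ∧ IsCompact L) ⟨∅, by simp, by simp⟩ ⟨∅, by simp, by simp⟩ ?_
  rintro K ⟨hKA, hK⟩ L ⟨hLB, hL⟩
  -- Adding a point to each of the compact sets keeps them nonempty.
  refine (add_le_add (measure_mono (Set.subset_insert a K))
    (measure_mono (Set.subset_insert b L))).trans ?_
  refine volume_add_volume_le_of_isCompact (hK.insert a) (hL.insert b) (Set.insert_nonempty _ _)
    (Set.insert_nonempty _ _) ((Set.add_subset_add ?_ ?_).trans hC)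
  · exact Set.insert_subset ha hKA
  · exact Set.insert_subset hb hLB

/-- The one-dimensional Prékopa–Leindler inequality, in its stronger arithmetic form, for functions
with supremum `1`: apply Brunn–Minkowski to the superlevel sets and integrate over the levels. -/
theorem lintegral_convexComb_le {f g h : ℝ → ℝ} {a b : ℝ} (ha : 0 < a) (hb : 0 < b)
    (hab : a + b = 1) (hf : Measurable f) (hg : Measurable g) (hh : Measurable h)
    (hf0 : ∀ x, 0 ≤ f x) (hg0 : ∀ x, 0 ≤ g x) (hh0 : ∀ x, 0 ≤ h x)
    (hf1 : ∀ x, f x ≤ 1) (hg1 : ∀ x, g x ≤ 1)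
    (hfs : ∀ t < 1, ∃ x, t < f x) (hgs : ∀ t < 1, ∃ x, t < g x)
    (H : ∀ x y, f x ^ a * g y ^ b ≤ h (a * x + b * y)) :
    ENNReal.ofReal a * (∫⁻ x, ENNReal.ofReal (f x)) +
      ENNReal.ofReal b * (∫⁻ x, ENNReal.ofReal (g x)) ≤ ∫⁻ x, ENNReal.ofReal (h x) := by
  have hmeas (u : ℝ → ℝ) : Measurable fun t => volume {x | t < u x} :=
    Antitone.measurable fun s t hst => measure_mono fun x hx => lt_of_le_of_lt hst hx
  rw [lintegral_eq_lintegral_meas_lt _ (.of_forall hf0) hf.aemeasurable,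
    lintegral_eq_lintegral_meas_lt _ (.of_forall hg0) hg.aemeasurable,
    lintegral_eq_lintegral_meas_lt _ (.of_forall hh0) hh.aemeasurable,
    ← lintegral_const_mul _ (hmeas f), ← lintegral_const_mul _ (hmeas g),
    ← lintegral_add_left ((hmeas f).const_mul _)]
  refine setLIntegral_mono (hmeas h) fun t (ht : 0 < t) => ?_
  rcases le_or_gt 1 t with h1 | h1
  · have e1 : {x | t < f x} = ∅ :=
      Set.eq_empty_iff_forall_notMem.2 fun x hx => (not_lt.2 ((hf1 x).trans h1)) hx
    have e2 : {x | t < g x} = ∅ :=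
      Set.eq_empty_iff_forall_notMem.2 fun x hx => (not_lt.2 ((hg1 x).trans h1)) hx
    simp [e1, e2]
  have scale {c : ℝ} (hc : 0 < c) (s : Set ℝ) :
      ENNReal.ofReal c * volume s = volume (c • s) := by
    rw [Measure.addHaar_smul]; simp [abs_of_pos hc]
  rw [scale ha, scale hb]
  refine volume_add_volume_le ((measurableSet_lt measurable_const hf).const_smul₀ a)
    ((measurableSet_lt measurable_const hg).const_smul₀ b)
    (Set.Nonempty.smul_set (hfs t h1)) (Set.Nonempty.smul_set (hgs t h1)) ?_
  rintro _ ⟨_, ⟨x, hx, rfl⟩, _, ⟨y, hy, rfl⟩, rfl⟩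
  refine lt_of_lt_of_le ?_ (H x y)
  calc t = t ^ a * t ^ b := by rw [← Real.rpow_add ht, hab, Real.rpow_one]
    _ < f x ^ a * g y ^ b :=
      mul_lt_mul'' (Real.rpow_lt_rpow ht.le hx ha) (Real.rpow_lt_rpow ht.le hy hb)
        (by positivity) (by positivity)

theorem ENNReal.geom_mean_le_arith_mean2 (x y : ℝ≥0∞) {a b : ℝ} (ha : 0 < a) (hb : 0 < b)
    (hab : a + b = 1) : x ^ a * y ^ b ≤ ENNReal.ofReal a * x + ENNReal.ofReal b * y := by
  have hpq : (a⁻¹).HolderConjugate b⁻¹ := by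
    rw [Real.holderConjugate_iff]
    refine ⟨(one_lt_inv₀ ha).2 (by linarith), by simpa using hab⟩
  have := ENNReal.young_inequality (x ^ a) (y ^ b) hpq
  rwa [← ENNReal.rpow_mul, ← ENNReal.rpow_mul, mul_inv_cancel₀ ha.ne', mul_inv_cancel₀ hb.ne',
    ENNReal.rpow_one, ENNReal.rpow_one, ENNReal.ofReal_inv_of_pos ha, ENNReal.ofReal_inv_of_pos hb,
    div_eq_mul_inv, div_eq_mul_inv, inv_inv, inv_inv, mul_comm x, mul_comm y] at this

/-- A measure `μ` on a real vector space satisfies the Prékopa–Leindler inequality if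
`(∫ f)ᵃ (∫ g)ᵇ ≤ ∫ h` whenever `a + b = 1` and `f x ᵃ g y ᵇ ≤ h (a x + b y)` for all `x` and `y`.
Only bounded functions `f` and `g` are considered; this class is stable under taking marginals
with respect to a finite measure. -/
def IsPrekopaLeindler {V : Type*} [AddCommGroup V] [Module ℝ V] [MeasurableSpace V]
    (μ : Measure V) : Prop :=
  ∀ ⦃a b : ℝ⦄, 0 < a → 0 < b → a + b = 1 → ∀ ⦃f g h : V → ℝ≥0∞⦄, Measurable f → Measurable g →
    Measurable h → (∃ M ≠ ∞, ∀ x, f x ≤ M) → (∃ M ≠ ∞, ∀ x, g x ≤ M) →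
    (∀ x y, f x ^ a * g y ^ b ≤ h (a • x + b • y)) →
    (∫⁻ x, f x ∂μ) ^ a * (∫⁻ x, g x ∂μ) ^ b ≤ ∫⁻ x, h x ∂μ

/-- Normalising the suprema of `f` and `g` to `1` reduces to `lintegral_convexComb_le`; the target
function is cut off at `1` to keep it finite. -/
theorem isPrekopaLeindler_volume : IsPrekopaLeindler (volume : Measure ℝ) := by
  rintro a b ha hb hab f g h hf hg hh ⟨M, hM, hfM⟩ ⟨N, hN, hgN⟩ H
  set S := ⨆ x, f x with hS
  set T := ⨆ x, g x with hT
  have hfS : ∀ x, f x ≤ S := le_iSup f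
  have hgT : ∀ x, g x ≤ T := le_iSup g
  have hSt : S ≠ ∞ := ne_top_of_le_ne_top hM (iSup_le hfM)
  have hTt : T ≠ ∞ := ne_top_of_le_ne_top hN (iSup_le hgN)
  rcases eq_or_ne S 0 with hS0 | hS0
  · have : ∀ x, f x = 0 := fun x => le_antisymm ((hfS x).trans hS0.le) zero_le
    simp [this, ENNReal.zero_rpow_of_pos ha]
  rcases eq_or_ne T 0 with hT0 | hT0
  · have : ∀ x, g x = 0 := fun x => le_antisymm ((hgT x).trans hT0.le) zero_le
    simp [this, ENNReal.zero_rpow_of_pos hb]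
  set D := S ^ a * T ^ b with hD
  have hSa : S ^ a ≠ 0 := (ENNReal.rpow_pos hS0.bot_lt hSt).ne'
  have hTb : T ^ b ≠ 0 := (ENNReal.rpow_pos hT0.bot_lt hTt).ne'
  have hD0 : D ≠ 0 := mul_ne_zero hSa hTb
  have hDt : D ≠ ∞ := ENNReal.mul_ne_top (ENNReal.rpow_ne_top_of_nonneg ha.le hSt)
    (ENNReal.rpow_ne_top_of_nonneg hb.le hTt)
  have hf1 : ∀ x, f x / S ≤ 1 := fun x => ENNReal.div_le_of_le_mul (by simpa using hfS x)
  have hg1 : ∀ x, g x / T ≤ 1 := fun x => ENNReal.div_le_of_le_mul (by simpa using hgT x)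
  have hft : ∀ x, f x / S ≠ ∞ := fun x => ne_top_of_le_ne_top ENNReal.one_ne_top (hf1 x)
  have hgt : ∀ x, g x / T ≠ ∞ := fun x => ne_top_of_le_ne_top ENNReal.one_ne_top (hg1 x)
  have hht : ∀ x, min (h x / D) 1 ≠ ∞ := fun x =>
    ne_top_of_le_ne_top ENNReal.one_ne_top (min_le_right _ _)
  have hsup (u : ℝ → ℝ≥0∞) (U : ℝ≥0∞) (hU : U = ⨆ x, u x) (hU0 : U ≠ 0) (hUt : U ≠ ∞)
      (hut : ∀ x, u x / U ≠ ∞) (t : ℝ) (ht : t < 1) : ∃ x, t < (u x / U).toReal := by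
    have h1 : ENNReal.ofReal t * U < U := by
      conv_rhs => rw [← one_mul U]
      exact (ENNReal.mul_lt_mul_iff_left hU0 hUt).2 (by simpa using ht)
    conv_rhs at h1 => rw [hU]
    obtain ⟨x, hx⟩ := lt_iSup_iff.1 h1
    refine ⟨x, lt_of_not_ge fun hle => hx.not_ge ?_⟩
    calc u x = u x / U * U := (ENNReal.div_mul_cancel hU0 hUt).symm
      _ = ENNReal.ofReal (u x / U).toReal * U := by rw [ENNReal.ofReal_toReal (hut x)]
      _ ≤ ENNReal.ofReal t * U := by gcongr
  have key := lintegral_convexComb_le (f := fun x => (f x / S).toReal)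
    (g := fun x => (g x / T).toReal) (h := fun x => (min (h x / D) 1).toReal) ha hb hab
    (by fun_prop) (by fun_prop) (by fun_prop) (fun _ => ENNReal.toReal_nonneg)
    (fun _ => ENNReal.toReal_nonneg) (fun _ => ENNReal.toReal_nonneg)
    (fun x => ENNReal.toReal_le_of_le_ofReal zero_le_one (by simpa using hf1 x))
    (fun x => ENNReal.toReal_le_of_le_ofReal zero_le_one (by simpa using hg1 x))
    (hsup f S hS hS0 hSt hft) (hsup g T hT hT0 hTt hgt) ?_
  · simp only [ENNReal.ofReal_toReal (hft _), ENNReal.ofReal_toReal (hgt _),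
      ENNReal.ofReal_toReal (hht _)] at key
    calc (∫⁻ x, f x) ^ a * (∫⁻ x, g x) ^ b
        = (S * ∫⁻ x, f x / S) ^ a * (T * ∫⁻ x, g x / T) ^ b := by
          rw [← lintegral_const_mul _ (by fun_prop), ← lintegral_const_mul _ (by fun_prop)]
          simp_rw [ENNReal.mul_div_cancel hS0 hSt, ENNReal.mul_div_cancel hT0 hTt]
      _ = D * ((∫⁻ x, f x / S) ^ a * (∫⁻ x, g x / T) ^ b) := by
          rw [ENNReal.mul_rpow_of_nonneg _ _ ha.le, ENNReal.mul_rpow_of_nonneg _ _ hb.le, hD]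
          ring
      _ ≤ D * ∫⁻ x, min (h x / D) 1 := by
          gcongr
          exact (ENNReal.geom_mean_le_arith_mean2 _ _ ha hb hab).trans key
      _ ≤ D * ∫⁻ x, h x / D := by
          gcongr
          exact min_le_left _ _
      _ = ∫⁻ x, h x := by
          rw [← lintegral_const_mul _ (by fun_prop)]
          simp_rw [ENNReal.mul_div_cancel hD0 hDt]
  · intro x y
    rw [ENNReal.toReal_rpow, ENNReal.toReal_rpow, ← ENNReal.toReal_mul]
    refine ENNReal.toReal_mono (hht _) (le_min ?_ ?_)
    · rw [ENNReal.div_rpow_of_nonneg _ _ ha.le, ENNReal.div_rpow_of_nonneg _ _ hb.le]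
      refine le_trans (le_of_eq ?_) (ENNReal.div_le_div_right (H x y) D)
      rw [hD, div_eq_mul_inv, div_eq_mul_inv, div_eq_mul_inv,
        ENNReal.mul_inv (Or.inl hSa) (Or.inr hTb)]
      ring
    · exact mul_le_one' (ENNReal.rpow_le_one (hf1 x) ha.le) (ENNReal.rpow_le_one (hg1 y) hb.le)

theorem IsPrekopaLeindler.withDensity {V : Type*} [AddCommGroup V] [Module ℝ V]
    [MeasurableSpace V] {μ : Measure V} (hμ : IsPrekopaLeindler μ) {w : V → ℝ≥0∞}
    (hw : Measurable w) (hwb : ∃ M ≠ ∞, ∀ x, w x ≤ M)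
    (hlog : ∀ ⦃a b : ℝ⦄, 0 < a → 0 < b → a + b = 1 → ∀ x y, w x ^ a * w y ^ b ≤ w (a • x + b • y)) :
    IsPrekopaLeindler (μ.withDensity w) := by
  rintro a b ha hb hab f g h hf hg hh ⟨M, hM, hfM⟩ ⟨N, hN, hgN⟩ H
  obtain ⟨W, hW, hwW⟩ := hwb
  rw [lintegral_withDensity_eq_lintegral_mul _ hw hf,
    lintegral_withDensity_eq_lintegral_mul _ hw hg, lintegral_withDensity_eq_lintegral_mul _ hw hh]
  refine hμ ha hb hab (hw.mul hf) (hw.mul hg) (hw.mul hh)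
    ⟨W * M, ENNReal.mul_ne_top hW hM, fun x => mul_le_mul' (hwW x) (hfM x)⟩
    ⟨W * N, ENNReal.mul_ne_top hW hN, fun x => mul_le_mul' (hwW x) (hgN x)⟩ fun x y => ?_
  simp only [Pi.mul_apply]
  rw [ENNReal.mul_rpow_of_nonneg _ _ ha.le, ENNReal.mul_rpow_of_nonneg _ _ hb.le, mul_mul_mul_comm]
  exact mul_le_mul' (hlog ha hb hab x y) (H x y)

theorem isPrekopaLeindler_gaussianReal : IsPrekopaLeindler (gaussianReal 0 1) := by
  rw [gaussianReal_of_var_ne_zero 0 one_ne_zero]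
  refine isPrekopaLeindler_volume.withDensity (measurable_gaussianPDF 0 1) ?_ ?_
  · refine ⟨ENNReal.ofReal (√(2 * Real.pi * 1))⁻¹, ENNReal.ofReal_ne_top, fun x => ?_⟩
    refine ENNReal.ofReal_le_ofReal ?_
    rw [gaussianPDFReal_def]
    refine mul_le_of_le_one_right (by positivity) (Real.exp_le_one_iff.2 ?_)
    have : 0 ≤ (x - 0) ^ 2 / (2 * ((1 : NNReal) : ℝ)) := by positivity
    rw [neg_div]; linarith
  · intro a b ha hb hab x y
    simp only [gaussianPDF]
    rw [ENNReal.ofReal_rpow_of_nonneg (gaussianPDFReal_nonneg _ _ _) ha.le,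
      ENNReal.ofReal_rpow_of_nonneg (gaussianPDFReal_nonneg _ _ _) hb.le,
      ← ENNReal.ofReal_mul (Real.rpow_nonneg (gaussianPDFReal_nonneg _ _ _) _)]
    refine ENNReal.ofReal_le_ofReal ?_
    simp only [gaussianPDFReal_def]
    set c := (√(2 * Real.pi * (1 : NNReal)))⁻¹
    have hc : 0 < c := by positivity
    rw [Real.mul_rpow hc.le (Real.exp_pos _).le, Real.mul_rpow hc.le (Real.exp_pos _).le,
      mul_mul_mul_comm, ← Real.rpow_add hc, hab, Real.rpow_one, ← Real.exp_mul, ← Real.exp_mul,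
      ← Real.exp_add]
    gcongr
    simp only [smul_eq_mul, NNReal.coe_one]
    have : b = 1 - a := by linarith
    subst this
    nlinarith [mul_nonneg (mul_nonneg ha.le hb.le) (sq_nonneg (x - y))]

/-- Tensorization: the hypothesis on `f`, `g`, `h` passes to their marginals by the inequality for
`ν`. -/
theorem IsPrekopaLeindler.prod {V W : Type*} [AddCommGroup V] [Module ℝ V] [MeasurableSpace V]
    [AddCommGroup W] [Module ℝ W] [MeasurableSpace W] {μ : Measure V} {ν : Measure W}
    [SFinite μ] [IsFiniteMeasure ν] (hμ : IsPrekopaLeindler μ) (hν : IsPrekopaLeindler ν) :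
    IsPrekopaLeindler (μ.prod ν) := by
  rintro a b ha hb hab f g h hf hg hh ⟨M, hM, hfM⟩ ⟨N, hN, hgN⟩ H
  rw [lintegral_prod _ hf.aemeasurable, lintegral_prod _ hg.aemeasurable,
    lintegral_prod _ hh.aemeasurable]
  have bound (u : V × W → ℝ≥0∞) (U : ℝ≥0∞) (hU : U ≠ ∞) (hu : ∀ z, u z ≤ U) :
      ∃ M ≠ ∞, ∀ x, ∫⁻ y, u (x, y) ∂ν ≤ M :=
    ⟨U * ν Set.univ, ENNReal.mul_ne_top hU (measure_ne_top _ _), fun x =>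
      (lintegral_mono fun y => hu (x, y)).trans (lintegral_const _).le⟩
  refine hμ ha hb hab hf.lintegral_prod_right' hg.lintegral_prod_right' hh.lintegral_prod_right'
    (bound f M hM hfM) (bound g N hN hgN) fun x x' => ?_
  exact hν ha hb hab (by fun_prop) (by fun_prop) (by fun_prop) ⟨M, hM, fun y => hfM _⟩
    ⟨N, hN, fun y => hgN _⟩ fun y y' => H (x, y) (x', y')

theorem IsPrekopaLeindler.map {V W : Type*} [AddCommGroup V] [Module ℝ V] [MeasurableSpace V]
    [AddCommGroup W] [Module ℝ W] [MeasurableSpace W] {μ : Measure V} (hμ : IsPrekopaLeindler μ)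
    (L : V →ₗ[ℝ] W) (hL : Measurable L) : IsPrekopaLeindler (μ.map L) := by
  rintro a b ha hb hab f g h hf hg hh ⟨M, hM, hfM⟩ ⟨N, hN, hgN⟩ H
  rw [lintegral_map hf hL, lintegral_map hg hL, lintegral_map hh hL]
  refine hμ ha hb hab (hf.comp hL) (hg.comp hL) (hh.comp hL) ⟨M, hM, fun y => hfM _⟩
    ⟨N, hN, fun y => hgN _⟩ fun x y => ?_
  simpa using H (L x) (L y)

theorem isPrekopaLeindler_pi_gaussianReal (n : ℕ) :
    IsPrekopaLeindler (Measure.pi fun _ : Fin n => gaussianReal 0 1) := by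
  induction n with
  | zero =>
    intro a b ha hb hab f g h hf hg hh _ _ H
    have := H 0 0
    rw [Measure.pi_of_empty _ 0]
    simpa [lintegral_dirac] using this
  | succ n ih =>
    let L : (ℝ × (Fin n → ℝ)) →ₗ[ℝ] (Fin (n + 1) → ℝ) :=
      { toFun := fun p => Fin.cons p.1 p.2
        map_add' := fun p q => by
          ext i; refine Fin.cases ?_ (fun j => ?_) i <;> simp
        map_smul' := fun c p => by
          ext i; refine Fin.cases ?_ (fun j => ?_) i <;> simp }
    have hmp := (measurePreserving_piFinSuccAbove
      (fun _ : Fin (n + 1) => gaussianReal 0 1) 0).symm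
    have hL : ⇑L = (MeasurableEquiv.piFinSuccAbove (fun _ : Fin (n + 1) => ℝ) 0).symm := by
      ext p i
      simp [L, MeasurableEquiv.piFinSuccAbove_symm_apply, Fin.insertNthEquiv]
    rw [← hmp.map_eq, ← hL]
    exact (isPrekopaLeindler_gaussianReal.prod ih).map L (hL ▸ hmp.measurable)

theorem isPrekopaLeindler_stdGaussian (E : Type*) [NormedAddCommGroup E] [InnerProductSpace ℝ E]
    [FiniteDimensional ℝ E] [MeasurableSpace E] [BorelSpace E] :
    IsPrekopaLeindler (stdGaussian E) := by
  let L : (Fin (Module.finrank ℝ E) → ℝ) →ₗ[ℝ] E :=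
    { toFun := fun x => ∑ i, x i • stdOrthonormalBasis ℝ E i
      map_add' := fun x y => by simp [add_smul, Finset.sum_add_distrib]
      map_smul' := fun c x => by simp [Finset.smul_sum, mul_smul] }
  exact (isPrekopaLeindler_pi_gaussianReal _).map L
    (L.continuous_of_finiteDimensional.measurable)

/-- Log-concavity of a measure satisfying the Prékopa–Leindler inequality, in the form
`μ(K)ᵃ μ(L)ᵇ ≤ μ(aK + bL)`. -/
theorem IsPrekopaLeindler.measure_rpow_mul_le {V : Type*} [AddCommGroup V] [Module ℝ V]
    [MeasurableSpace V] {μ : Measure V} (hμ : IsPrekopaLeindler μ) {a b : ℝ} (ha : 0 < a)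
    (hb : 0 < b) (hab : a + b = 1) {K L C : Set V} (hK : MeasurableSet K) (hL : MeasurableSet L)
    (hC : MeasurableSet C) (H : ∀ x ∈ K, ∀ y ∈ L, a • x + b • y ∈ C) :
    μ K ^ a * μ L ^ b ≤ μ C := by
  have bound (S : Set V) : ∃ M ≠ ∞, ∀ x, S.indicator (1 : V → ℝ≥0∞) x ≤ M :=
    ⟨1, ENNReal.one_ne_top, fun x => Set.indicator_le_self' (by simp) x⟩
  have := hμ ha hb hab (f := K.indicator 1) (g := L.indicator 1) (h := C.indicator 1)
    (measurable_one.indicator hK) (measurable_one.indicator hL) (measurable_one.indicator hC)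
    (bound K) (bound L) fun x y => ?_
  · simpa [lintegral_indicator_one hK, lintegral_indicator_one hL, lintegral_indicator_one hC]
      using this
  · by_cases hx : x ∈ K
    · by_cases hy : y ∈ L
      · simp [hx, hy, H x hx y hy]
      · simp [hy, ENNReal.zero_rpow_of_pos hb]
    · simp [hx, ENNReal.zero_rpow_of_pos ha]

/-! ### Slices of symmetric convex sets -/

section Slices

variable {E : Type*} [NormedAddCommGroup E] [InnerProductSpace ℝ E] [FiniteDimensional ℝ E]
  [MeasurableSpace E] [BorelSpace E]

/-- Replacing the coordinate of a standard Gaussian vector along a unit vector by an independent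
normal variable does not change its law. -/
theorem map_replaceCoord_stdGaussian {v : E} (hv : ‖v‖ = 1) :
    ((stdGaussian E).prod (gaussianReal 0 1)).map
      (fun p => p.1 - ⟪v, p.1⟫ • v + p.2 • v) = stdGaussian E := by
  apply Measure.ext_of_charFun
  ext t
  rw [charFun_apply, integral_map (by fun_prop) (by fun_prop), charFun_stdGaussian]
  have h (p : E × ℝ) : Complex.exp (⟪p.1 - ⟪v, p.1⟫ • v + p.2 • v, t⟫ * Complex.I)
      = Complex.exp (⟪p.1, t - ⟪v, t⟫ • v⟫ * Complex.I)
        * Complex.exp (p.2 * ⟪v, t⟫ * Complex.I) := by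
    rw [← Complex.exp_add]
    congr 1
    simp only [inner_add_left, inner_sub_left, inner_sub_right, real_inner_smul_left,
      real_inner_smul_right]
    rw [real_inner_comm v p.1]
    push_cast
    ring
  simp_rw [h]
  rw [integral_prod_mul (fun x : E => Complex.exp (⟪x, t - ⟪v, t⟫ • v⟫ * Complex.I))
    (fun s : ℝ => Complex.exp (s * ⟪v, t⟫ * Complex.I)), ← charFun_apply, charFun_stdGaussian]
  have h2 : ∫ s : ℝ, Complex.exp (s * ⟪v, t⟫ * Complex.I) ∂(gaussianReal 0 1)
      = Complex.exp (-(⟪v, t⟫ : ℂ) ^ 2 / 2) := by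
    have := charFun_gaussianReal (μ := 0) (v := 1) ⟪v, t⟫
    rw [charFun_apply_real] at this
    simp_rw [mul_comm (_ : ℂ) ((⟪v, t⟫ : ℝ) : ℂ)]
    rw [this]
    congr 1
    simp
    ring
  rw [h2, ← Complex.exp_add]
  congr 1
  have h3 : ‖t - ⟪v, t⟫ • v‖ ^ 2 = ‖t‖ ^ 2 - ⟪v, t⟫ ^ 2 := by
    rw [norm_sub_sq_real, real_inner_smul_right, norm_smul, hv, real_inner_comm v t]
    simp
    ring
  have h3' : ((‖t - ⟪v, t⟫ • v‖ : ℝ) : ℂ) ^ 2 = (‖t‖ : ℂ) ^ 2 - (⟪v, t⟫ : ℂ) ^ 2 := by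
    exact_mod_cast congrArg (fun r : ℝ => (r : ℂ)) h3
  rw [h3']
  ring

/-- The slice of `F` at height `t` in the direction `v`, made into a subset of the whole space that
does not depend on the coordinate along `v`. -/
def slice (F : Set E) (v : E) (t : ℝ) : Set E := {x | x - ⟪v, x⟫ • v + t • v ∈ F}

theorem measurableSet_slice {F : Set E} (hF : MeasurableSet F) (v : E) (t : ℝ) :
    MeasurableSet (slice F v t) :=
  (show Measurable fun x : E => x - ⟪v, x⟫ • v + t • v by fun_prop) hF

theorem stdGaussian_slice_neg {F : Set E} (hF : MeasurableSet F) (hs : ∀ x ∈ F, -x ∈ F) (v : E)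
    (t : ℝ) : stdGaussian E (slice F v (-t)) = stdGaussian E (slice F v t) := by
  conv_rhs => rw [← stdGaussian_map (LinearIsometryEquiv.neg ℝ (E := E))]
  rw [Measure.map_apply (by fun_prop) (measurableSet_slice hF v t)]
  congr 1
  ext x
  simp only [slice, Set.mem_ofPred_eq, Set.mem_preimage, LinearIsometryEquiv.coe_neg,
    inner_neg_right]
  constructor <;> intro h <;> · convert hs _ h using 1; module

/-- A slice at height `s` with `|s| ≤ |t|` contains a convex combination of the slices at heights
`t` and `-t`, which have the same measure. -/
theorem stdGaussian_slice_anti {F : Set E} (hF : MeasurableSet F) (hc : Convex ℝ F)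
    (hs : ∀ x ∈ F, -x ∈ F) (v : E) {s t : ℝ} (hst : |s| ≤ |t|) :
    stdGaussian E (slice F v t) ≤ stdGaussian E (slice F v s) := by
  rcases hst.lt_or_eq with h | h
  · have ht : t ≠ 0 := by rintro rfl; simp at h; linarith [abs_nonneg s]
    have h1 : |s / t| < 1 := by
      rw [abs_div, div_lt_one (abs_pos.2 ht)]; exact h
    obtain ⟨h2, h3⟩ := abs_lt.1 h1
    have key := (isPrekopaLeindler_stdGaussian E).measure_rpow_mul_le
      (a := (1 + s / t) / 2) (b := (1 - s / t) / 2) (by linarith) (by linarith) (by ring)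
      (measurableSet_slice hF v t) (measurableSet_slice hF v (-t)) (measurableSet_slice hF v s) ?_
    · rwa [stdGaussian_slice_neg hF hs, ← ENNReal.rpow_add_of_nonneg _ _ (by linarith)
        (by linarith), show (1 + s / t) / 2 + (1 - s / t) / 2 = 1 by ring, ENNReal.rpow_one] at key
    · intro x hx y hy
      have := hc hx hy (a := (1 + s / t) / 2) (b := (1 - s / t) / 2) (by linarith) (by linarith)
        (by ring)
      -- The weights `(1 ± s / t) / 2` express `s` as a convex combination of `t` and `-t`.
      have e : s = (1 + s / t) / 2 * t + (1 - s / t) / 2 * (-t) := by field_simp; ring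
      simp only [slice, Set.mem_ofPred_eq, inner_add_right, real_inner_smul_right]
      convert this using 1
      have e' : s • v = ((1 + s / t) / 2 * t + (1 - s / t) / 2 * (-t)) • v :=
        congrArg (fun r : ℝ => r • v) e
      rw [e']
      generalize (1 + s / t) / 2 = a
      generalize (1 - s / t) / 2 = b
      module
  · rcases abs_eq_abs.1 h with rfl | rfl
    · rfl
    · rw [stdGaussian_slice_neg hF hs]

theorem integrable_inner_sq_stdGaussian (v : E) :
    Integrable (fun x : E => ⟪v, x⟫ ^ 2) (stdGaussian E) :=
  (IsGaussian.memLp_dual (stdGaussian E) (innerSL ℝ v) 2 (by simp)).integrable_sq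

theorem setIntegral_one_sub_inner_sq_eq {F : Set E} (hF : MeasurableSet F) {v : E} (hv : ‖v‖ = 1) :
    ∫ x in F, (1 - ⟪v, x⟫ ^ 2) ∂(stdGaussian E)
      = ∫ t, (1 - t ^ 2) * (stdGaussian E).real (slice F v t) ∂(gaussianReal 0 1) := by
  have hint : Integrable (F.indicator fun x => 1 - ⟪v, x⟫ ^ 2) (stdGaussian E) :=
    ((integrable_const _).sub (integrable_inner_sq_stdGaussian v)).indicator hF
  have hmeas : Measurable fun p : E × ℝ => p.1 - ⟪v, p.1⟫ • v + p.2 • v := by fun_prop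
  have hvv : ⟪v, v⟫ = 1 := by simp [hv]
  have e (x : E) (t : ℝ) : (F.indicator fun x => 1 - ⟪v, x⟫ ^ 2) (x - ⟪v, x⟫ • v + t • v)
      = (1 - t ^ 2) * (slice F v t).indicator (fun _ => (1 : ℝ)) x := by
    by_cases hx : x - ⟪v, x⟫ • v + t • v ∈ F
    · have hx' : x ∈ slice F v t := hx
      simp only [hx, hx', Set.indicator_of_mem, inner_add_right, inner_sub_right,
        real_inner_smul_right, hvv]
      ring
    · have hx' : x ∉ slice F v t := hx
      simp [hx, hx']
  rw [← integral_indicator hF]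
  conv_lhs => rw [← map_replaceCoord_stdGaussian hv]
  rw [← map_replaceCoord_stdGaussian hv] at hint
  rw [integral_map hmeas.aemeasurable hint.aestronglyMeasurable, integral_prod_symm]
  · refine integral_congr_ae (.of_forall fun t => ?_)
    simp only [e, integral_const_mul]
    rw [integral_indicator_const _ (measurableSet_slice hF v t)]
    simp
  · exact hint.comp_measurable hmeas

theorem integral_one_sub_sq_gaussianReal : ∫ t : ℝ, (1 - t ^ 2) ∂(gaussianReal 0 1) = 0 := by
  have hm : MemLp (id : ℝ → ℝ) 2 (gaussianReal 0 1) := IsGaussian.memLp_two_id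
  have h := variance_id_gaussianReal (μ := 0) (v := 1)
  rw [variance_of_integral_eq_zero (by fun_prop) (by simp)] at h
  simp only [id] at h
  rw [integral_sub (integrable_const _) (by simpa using hm.integrable_sq), h]
  simp

/-- Subtracting the constant `h(1)` is harmless because `1 - t²` has mean zero; it makes the
integrand nonnegative when `F` is convex and symmetric. -/
theorem setIntegral_one_sub_inner_sq_eq_centered {F : Set E} (hF : MeasurableSet F) {v : E}
    (hv : ‖v‖ = 1) :
    Integrable (fun t : ℝ => (1 - t ^ 2) *
      ((stdGaussian E).real (slice F v t) - (stdGaussian E).real (slice F v 1)))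
      (gaussianReal 0 1) ∧
    ∫ x in F, (1 - ⟪v, x⟫ ^ 2) ∂(stdGaussian E)
      = ∫ t, (1 - t ^ 2) * ((stdGaussian E).real (slice F v t) - (stdGaussian E).real (slice F v 1))
          ∂(gaussianReal 0 1) := by
  have hm : MemLp (id : ℝ → ℝ) 2 (gaussianReal 0 1) := IsGaussian.memLp_two_id
  have h1 : Integrable (fun t : ℝ => 1 - t ^ 2) (gaussianReal 0 1) :=
    (integrable_const _).sub hm.integrable_sq
  have hmeas : Measurable fun t => (stdGaussian E).real (slice F v t) := by
    have : MeasurableSet {p : ℝ × E | p.2 - ⟪v, p.2⟫ • v + p.1 • v ∈ F} :=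
      (show Measurable fun p : ℝ × E => p.2 - ⟪v, p.2⟫ • v + p.1 • v by fun_prop) hF
    exact (measurable_measure_prodMk_left this).ennreal_toReal
  have h2 : Integrable (fun t : ℝ => (1 - t ^ 2) * (stdGaussian E).real (slice F v t))
      (gaussianReal 0 1) :=
    h1.mul_bdd (c := 1) hmeas.aestronglyMeasurable (.of_forall fun t => by
      simp [abs_of_nonneg measureReal_nonneg, measureReal_le_one])
  simp_rw [mul_sub]
  refine ⟨h2.sub (h1.mul_const _), ?_⟩
  rw [setIntegral_one_sub_inner_sq_eq hF hv, integral_sub h2 (h1.mul_const _), integral_mul_const,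
    integral_one_sub_sq_gaussianReal]
  simp

theorem one_sub_sq_mul_slice_nonneg {F : Set E} (hF : MeasurableSet F) (hc : Convex ℝ F)
    (hs : ∀ x ∈ F, -x ∈ F) (v : E) (t : ℝ) :
    0 ≤ (1 - t ^ 2) *
      ((stdGaussian E).real (slice F v t) - (stdGaussian E).real (slice F v 1)) := by
  have mono {s t : ℝ} (hst : |s| ≤ |t|) :
      (stdGaussian E).real (slice F v t) ≤ (stdGaussian E).real (slice F v s) :=
    ENNReal.toReal_mono (measure_ne_top _ _) (stdGaussian_slice_anti hF hc hs v hst)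
  rcases le_total |t| 1 with h | h
  · exact mul_nonneg (by nlinarith [sq_abs t, abs_nonneg t])
      (sub_nonneg.2 (mono (by simpa using h)))
  · exact mul_nonneg_of_nonpos_of_nonpos (by nlinarith [sq_abs t, abs_nonneg t])
      (sub_nonpos.2 (mono (by simpa using h)))

theorem setIntegral_one_sub_inner_sq_nonneg {F : Set E} (hF : MeasurableSet F) (hc : Convex ℝ F)
    (hs : ∀ x ∈ F, -x ∈ F) {v : E} (hv : ‖v‖ = 1) :
    0 ≤ ∫ x in F, (1 - ⟪v, x⟫ ^ 2) ∂(stdGaussian E) := by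
  rw [(setIntegral_one_sub_inner_sq_eq_centered hF hv).2]
  exact integral_nonneg (one_sub_sq_mul_slice_nonneg hF hc hs v)

/-- In the case of equality almost all slices have the measure of the slice at height `1`, which is
positive since `F` has positive measure; monotonicity extends the bound to every height. -/
theorem exists_pos_le_stdGaussian_slice {F : Set E} (hF : MeasurableSet F) (hc : Convex ℝ F)
    (hs : ∀ x ∈ F, -x ∈ F) (hpos : stdGaussian E F ≠ 0) {v : E} (hv : ‖v‖ = 1)
    (h0 : ∫ x in F, (1 - ⟪v, x⟫ ^ 2) ∂(stdGaussian E) = 0) :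
    ∃ c > 0, ∀ t, c ≤ stdGaussian E (slice F v t) := by
  rw [(setIntegral_one_sub_inner_sq_eq_centered hF hv).2, integral_eq_zero_iff_of_nonneg
    (one_sub_sq_mul_slice_nonneg hF hc hs v)
    (setIntegral_one_sub_inner_sq_eq_centered hF hv).1] at h0
  have hne : NullSingletonClass (gaussianReal 0 1) := nullSingletonClass_gaussianReal one_ne_zero
  have hae : ∀ᵐ t ∂(gaussianReal 0 1),
      stdGaussian E (slice F v t) = stdGaussian E (slice F v 1) := by
    have a1 : ∀ᵐ t ∂(gaussianReal 0 1), t ≠ 1 := by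
      simp [ae_iff, measure_singleton]
    have a2 : ∀ᵐ t ∂(gaussianReal 0 1), t ≠ -1 := by
      simp [ae_iff, measure_singleton]
    filter_upwards [h0, a1, a2] with t h h1 h2
    rcases mul_eq_zero.1 h with h | h
    · rcases sq_eq_one_iff.1 (sub_eq_zero.1 h).symm with h | h <;> contradiction
    · rw [← ENNReal.toReal_eq_toReal_iff' (measure_ne_top _ _) (measure_ne_top _ _)]
      exact sub_eq_zero.1 h
  refine ⟨stdGaussian E (slice F v 1), ?_, fun t => ?_⟩
  · refine pos_iff_ne_zero.2 fun hz => hpos ?_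
    have hmeas : Measurable fun p : E × ℝ => p.1 - ⟪v, p.1⟫ • v + p.2 • v := by fun_prop
    conv_lhs => rw [← map_replaceCoord_stdGaussian hv]
    rw [Measure.map_apply hmeas hF, Measure.prod_apply_symm (hmeas hF)]
    refine (lintegral_congr_ae (g := 0) ?_).trans (by simp)
    filter_upwards [hae] with t ht
    exact ht.trans hz
  · have : ∃ s, |t| ≤ |s| ∧ stdGaussian E (slice F v s) = stdGaussian E (slice F v 1) := by
      by_contra! hcon
      have h1 : gaussianReal 0 1 (Set.Ioi |t|) = 0 :=
        measure_mono_null (fun s (hs : |t| < s) => hcon s (hs.le.trans (le_abs_self s)))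
          (ae_iff.1 hae)
      have := gaussianReal_absolutelyContinuous' 0 one_ne_zero h1
      simp at this
    obtain ⟨s, hts, e⟩ := this
    rw [← e]
    exact stdGaussian_slice_anti hF hc hs v hts

/-- In the case of equality `F` is invariant under translation along `v`: slices whose mass is
bounded below meet a fixed ball, so `F` contains points at bounded distance from `t v` for every
`t`, and convex combinations of these with `y` converge to `y + s v`. -/
theorem add_smul_mem_of_setIntegral_eq_zero {F : Set E} (hF : IsClosed F) (hc : Convex ℝ F)
    (hs : ∀ x ∈ F, -x ∈ F) (hpos : stdGaussian E F ≠ 0) {v : E} (hv : ‖v‖ = 1)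
    (h0 : ∫ x in F, (1 - ⟪v, x⟫ ^ 2) ∂(stdGaussian E) = 0) {y : E} (hy : y ∈ F) (s : ℝ) :
    y + s • v ∈ F := by
  obtain ⟨c, hc0, hcs⟩ := exists_pos_le_stdGaussian_slice hF.measurableSet hc hs hpos hv h0
  obtain ⟨R, hR⟩ : ∃ R : ℕ, stdGaussian E (Metric.closedBall 0 (R : ℝ))ᶜ < c := by
    have ht : Tendsto (fun n : ℕ => stdGaussian E (Metric.closedBall (0 : E) (n : ℝ))ᶜ) atTop
        (𝓝 (stdGaussian E (⋂ n : ℕ, (Metric.closedBall (0 : E) (n : ℝ))ᶜ))) := by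
      refine tendsto_measure_iInter_atTop
        (fun n => Metric.isClosed_closedBall.measurableSet.compl.nullMeasurableSet)
        (fun m n hmn => ?_) ⟨0, measure_ne_top _ _⟩
      exact Set.compl_subset_compl.2 (Metric.closedBall_subset_closedBall (by exact_mod_cast hmn))
    have he : (⋂ n : ℕ, (Metric.closedBall (0 : E) (n : ℝ))ᶜ) = ∅ := by
      rw [← Set.compl_iUnion, Metric.iUnion_closedBall_nat, Set.compl_univ]
    rw [he, measure_empty] at ht
    exact (ht.eventually (gt_mem_nhds hc0)).exists
  have hpt (t : ℝ) : ∃ w : E, ‖w‖ ≤ R + R ∧ w + t • v ∈ F := by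
    have hnot : ¬ slice F v t ⊆ (Metric.closedBall 0 (R : ℝ))ᶜ := fun hsub =>
      ((hcs t).trans (measure_mono hsub)).not_gt hR
    obtain ⟨x, hx, hxR⟩ := Set.not_subset.1 hnot
    rw [Set.notMem_compl_iff, mem_closedBall_zero_iff] at hxR
    refine ⟨x - ⟪v, x⟫ • v, (norm_sub_le _ _).trans (add_le_add hxR ?_), hx⟩
    rw [norm_smul, hv, mul_one]
    refine (norm_inner_le_norm v x).trans ?_
    rwa [hv, one_mul]
  choose w hw hwF using hpt
  have hlim : Tendsto (fun n : ℕ => (1 - 1 / ((n : ℝ) + 1)) • y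
      + (1 / ((n : ℝ) + 1)) • (w (((n : ℝ) + 1) * s) + (((n : ℝ) + 1) * s) • v)) atTop
      (𝓝 (y + s • v)) := by
    have h1 : Tendsto (fun n : ℕ => 1 / ((n : ℝ) + 1)) atTop (𝓝 0) :=
      tendsto_one_div_add_atTop_nhds_zero_nat
    have h2 : Tendsto (fun n : ℕ => (1 / ((n : ℝ) + 1)) • w (((n : ℝ) + 1) * s)) atTop (𝓝 0) := by
      refine squeeze_zero_norm (a := fun n : ℕ => 1 / ((n : ℝ) + 1) * (R + R)) (fun n => ?_) ?_
      · rw [norm_smul, Real.norm_of_nonneg (by positivity)]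
        gcongr
        exact hw _
      · simpa using h1.mul_const ((R : ℝ) + R)
    have h3 := (((tendsto_const_nhds (x := (1 : ℝ))).sub h1).smul_const y).add
      (h2.add (tendsto_const_nhds (x := s • v)))
    simp only [sub_zero, one_smul, zero_add] at h3
    refine h3.congr fun n => ?_
    rw [smul_add, smul_smul]
    congr 3
    field_simp
  refine hF.mem_of_tendsto hlim (.of_forall fun n => ?_)
  have hn : 1 / ((n : ℝ) + 1) ≤ 1 := by
    rw [div_le_one (by positivity)]
    linarith [(Nat.cast_nonneg n : (0 : ℝ) ≤ n)]
  exact hc hy (hwF _) (by linarith) (by positivity) (by ring)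

end Slices

/-! ### Densities and linear images of Gaussian measures -/

section Density

variable {E : Type*} [NormedAddCommGroup E] [InnerProductSpace ℝ E] [FiniteDimensional ℝ E]
  [MeasurableSpace E] [BorelSpace E]

theorem stdGaussian_eq_withDensity :
    stdGaussian E = volume.withDensity fun x : E => ENNReal.ofReal
      ((2 * Real.pi) ^ (-(Module.finrank ℝ E / 2 : ℝ)) * Real.exp (-‖x‖ ^ 2 / 2)) := by
  set c : ℝ := (2 * Real.pi) ^ (-(Module.finrank ℝ E / 2 : ℝ)) with hc
  have hc0 : 0 ≤ c := by positivity
  have hb : 0 < ((1 / 2 : ℂ)).re := by norm_num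
  have hint : Integrable (fun x : E => c * Real.exp (-‖x‖ ^ 2 / 2)) := by
    have h := (GaussianFourier.integrable_cexp_neg_mul_sq_norm_add hb 0 (0 : E)).re
    refine (h.congr (.of_forall fun x => ?_)).const_mul c
    have : (-(1 / 2 : ℂ) * (‖x‖ : ℂ) ^ 2 + 0 * ((⟪(0 : E), x⟫ : ℝ) : ℂ))
        = ((-‖x‖ ^ 2 / 2 : ℝ) : ℂ) := by push_cast; ring
    simp only [this]
    exact Complex.exp_ofReal_re _
  have hfin : IsFiniteMeasure (volume.withDensity fun x : E => ENNReal.ofReal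
      (c * Real.exp (-‖x‖ ^ 2 / 2))) :=
    isFiniteMeasure_withDensity_ofReal hint.2
  apply Measure.ext_of_charFun
  ext t
  rw [charFun_stdGaussian, charFun_apply, integral_withDensity_eq_integral_toReal_smul
    (by fun_prop) (.of_forall fun x => ENNReal.ofReal_lt_top)]
  have e (x : E) : (ENNReal.ofReal (c * Real.exp (-‖x‖ ^ 2 / 2))).toReal •
      Complex.exp (⟪x, t⟫ * Complex.I)
      = (c : ℂ) * Complex.exp (-(1 / 2 : ℂ) * (‖x‖ : ℂ) ^ 2 + Complex.I * ⟪t, x⟫) := by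
    rw [ENNReal.toReal_ofReal (by positivity), Complex.real_smul, Complex.exp_add,
      real_inner_comm]
    push_cast
    rw [mul_assoc, mul_comm Complex.I]
    congr 3
    ring
  simp_rw [e]
  rw [integral_const_mul, GaussianFourier.integral_cexp_neg_mul_sq_norm_add hb]
  have h2 : (c : ℂ) * ((Real.pi : ℂ) / (1 / 2)) ^ ((Module.finrank ℝ E : ℂ) / 2) = 1 := by
    have : ((Real.pi : ℂ) / (1 / 2)) = ((2 * Real.pi : ℝ) : ℂ) := by push_cast; ring
    rw [this, hc]
    have h3 : ((Module.finrank ℝ E : ℂ) / 2) = ((Module.finrank ℝ E / 2 : ℝ) : ℂ) := by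
      push_cast; rfl
    rw [h3, ← Complex.ofReal_cpow (by positivity), ← Complex.ofReal_mul,
      ← Real.rpow_add (by positivity)]
    simp
  rw [← mul_assoc, h2, one_mul]
  congr 1
  rw [Complex.I_sq]
  ring

/-- Change of variables for the standard Gaussian measure. -/
theorem stdGaussian_map_equiv (L : E ≃L[ℝ] E) :
    (stdGaussian E).map L = (stdGaussian E).withDensity fun x => ENNReal.ofReal
      (|LinearMap.det (L : E →ₗ[ℝ] E)|⁻¹ * Real.exp ((‖x‖ ^ 2 - ‖L.symm x‖ ^ 2) / 2)) := by
  set w : E → ℝ≥0∞ := fun x => ENNReal.ofReal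
      ((2 * Real.pi) ^ (-(Module.finrank ℝ E / 2 : ℝ)) * Real.exp (-‖x‖ ^ 2 / 2)) with hw
  have hwm : Measurable w := by fun_prop
  have hL : Measurable L := L.continuous.measurable
  have hL' : Measurable L.symm := L.symm.continuous.measurable
  ext S hS
  rw [Measure.map_apply hL hS, withDensity_apply _ hS, stdGaussian_eq_withDensity,
    withDensity_apply _ (hL hS), restrict_withDensity hS,
    lintegral_withDensity_eq_lintegral_mul _ hwm (by fun_prop)]
  have hwL : Measurable fun y => w (L.symm y) := hwm.comp hL'
  have h1 : ∫⁻ x in L ⁻¹' S, w x = ∫⁻ y in S, w (L.symm y) ∂(volume.map L) := by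
    rw [setLIntegral_map hS hwL hL]
    simp
  have hdet : LinearMap.det (L : E →ₗ[ℝ] E) ≠ 0 := L.toLinearEquiv.isUnit_det'.ne_zero
  have h2 : (volume : Measure E).map L
      = ENNReal.ofReal |(LinearMap.det (L : E →ₗ[ℝ] E))⁻¹| • volume :=
    Measure.map_linearMap_addHaar_eq_smul_addHaar volume hdet
  rw [h1, h2, Measure.restrict_smul, lintegral_smul_measure, smul_eq_mul,
    ← lintegral_const_mul _ hwL]
  refine lintegral_congr fun y => ?_
  simp only [hw, Pi.mul_apply]
  rw [← ENNReal.ofReal_mul (by positivity), ← ENNReal.ofReal_mul (by positivity), abs_inv]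
  congr 1
  have e : Real.exp (-‖L.symm y‖ ^ 2 / 2)
      = Real.exp (-‖y‖ ^ 2 / 2) * Real.exp ((‖y‖ ^ 2 - ‖L.symm y‖ ^ 2) / 2) := by
    rw [← Real.exp_add]; congr 1; ring
  rw [e]
  ring

theorem stdGaussian_absolutelyContinuous : stdGaussian E ≪ volume := by
  rw [stdGaussian_eq_withDensity]
  exact withDensity_absolutelyContinuous _ _

end Density

section MatrixGaussian

variable {ι : Type*} [Fintype ι] [DecidableEq ι]

/-- The density of a nondegenerate centered Gaussian measure relative to the standard one. -/
theorem multivariateGaussian_eq_withDensity {S : Matrix ι ι ℝ} (hS : S.PosDef) :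
    multivariateGaussian 0 S = (stdGaussian (EuclideanSpace ℝ ι)).withDensity fun z =>
      ENNReal.ofReal ((√S.det)⁻¹ *
        Real.exp ((‖z‖ ^ 2 - ⟪z, toEuclideanCLM (𝕜 := ℝ) S⁻¹ z⟫) / 2)) := by
  set R := CFC.sqrt S with hR
  have hRR : R * R = S := CFC.sqrt_mul_sqrt_self _ hS.posSemidef.nonneg
  have hRH : R.IsHermitian := (CFC.sqrt_nonneg S).isSelfAdjoint
  have hRdet : R.det * R.det = S.det := by rw [← det_mul, hRR]
  have hdet : IsUnit R.det := by
    refine isUnit_iff_ne_zero.2 fun h => hS.det_pos.ne' ?_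
    rw [← hRdet, h, zero_mul]
  have h1 : toEuclideanCLM (𝕜 := ℝ) R * toEuclideanCLM (𝕜 := ℝ) R⁻¹ = 1 := by
    rw [← map_mul, mul_nonsing_inv _ hdet, map_one]
  have h2 : toEuclideanCLM (𝕜 := ℝ) R⁻¹ * toEuclideanCLM (𝕜 := ℝ) R = 1 := by
    rw [← map_mul, nonsing_inv_mul _ hdet, map_one]
  let L : EuclideanSpace ℝ ι ≃L[ℝ] EuclideanSpace ℝ ι :=
    ContinuousLinearEquiv.equivOfInverse (toEuclideanCLM (𝕜 := ℝ) R) (toEuclideanCLM (𝕜 := ℝ) R⁻¹)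
      (fun x => congrArg (fun T => T x) h2) (fun x => congrArg (fun T => T x) h1)
  have hmap : multivariateGaussian 0 S = (stdGaussian (EuclideanSpace ℝ ι)).map L := by
    rw [multivariateGaussian]
    simp [L, ← hR]
    rfl
  rw [hmap, stdGaussian_map_equiv]
  congr 1
  ext z
  have hLdet : LinearMap.det (L : EuclideanSpace ℝ ι →ₗ[ℝ] EuclideanSpace ℝ ι) = R.det := by
    have : (L : EuclideanSpace ℝ ι →ₗ[ℝ] EuclideanSpace ℝ ι) = toEuclideanLin R := rfl
    rw [this]
    exact LinearMap.det_toLin (EuclideanSpace.basisFun ι ℝ).toBasis R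
  have hnorm : ‖L.symm z‖ ^ 2 = ⟪z, toEuclideanCLM (𝕜 := ℝ) S⁻¹ z⟫ := by
    have hsym : (R⁻¹).IsHermitian := hRH.inv
    have h3 : S⁻¹ = R⁻¹ * R⁻¹ := by rw [← hRR, Matrix.mul_inv_rev]
    have h4 : IsSelfAdjoint (toEuclideanCLM (𝕜 := ℝ) R⁻¹) := IsSelfAdjoint.map hsym _
    rw [h3, map_mul, ContinuousLinearMap.mul_def, ContinuousLinearMap.comp_apply,
      ← ContinuousLinearMap.adjoint_inner_left,
      h4.adjoint_eq, real_inner_self_eq_norm_sq]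
    rfl
  rw [hLdet, hnorm, ← hRdet, Real.sqrt_mul_self_eq_abs]

theorem multivariateGaussian_absolutelyContinuous {S : Matrix ι ι ℝ} (hS : S.PosDef) :
    multivariateGaussian 0 S ≪ volume := by
  rw [multivariateGaussian_eq_withDensity hS]
  exact (withDensity_absolutelyContinuous _ _).trans stdGaussian_absolutelyContinuous

theorem multivariateGaussian_map {S : Matrix ι ι ℝ} (hS : S.PosSemidef) (M : Matrix ι ι ℝ) :
    (multivariateGaussian 0 S).map (toEuclideanCLM (𝕜 := ℝ) M)
      = multivariateGaussian 0 (M * S * Mᵀ) := by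
  apply Measure.ext_of_charFun
  ext t
  have hS' : (M * S * Mᵀ).PosSemidef := by
    simpa using hS.mul_mul_conjTranspose_same M
  have h (x : EuclideanSpace ℝ ι) : ⟪toEuclideanCLM (𝕜 := ℝ) M x, t⟫
      = ⟪x, toEuclideanCLM (𝕜 := ℝ) Mᵀ t⟫ := by
    rw [real_inner_comm, inner_toEuclideanCLM, inner_toEuclideanCLM, dotProduct_mulVec,
      dotProduct_comm, ← mulVec_transpose]
  rw [charFun_apply, integral_map (by fun_prop) (by fun_prop)]
  simp_rw [h]
  rw [← charFun_apply, charFun_multivariateGaussian hS, charFun_multivariateGaussian hS']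
  congr 2
  · simp
  · congr 2
    rw [ofLp_toEuclideanCLM, ← mulVec_mulVec, ← mulVec_mulVec, dotProduct_mulVec _ M,
      ← mulVec_transpose]

/-- Multiply the inequalities `l ≤ exp (l - 1)` over the eigenvalues `l`. -/
theorem Matrix.PosSemidef.det_le_exp_trace_sub {D : Matrix ι ι ℝ} (hD : D.PosSemidef) :
    D.det ≤ Real.exp (D.trace - Fintype.card ι) := by
  have hdet := hD.1.det_eq_prod_eigenvalues
  have htr := hD.1.trace_eq_sum_eigenvalues
  simp only [RCLike.ofReal_real_eq_id, id] at hdet htr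
  rw [hdet, htr]
  calc ∏ i, hD.1.eigenvalues i ≤ ∏ i, Real.exp (hD.1.eigenvalues i - 1) :=
        Finset.prod_le_prod (fun i _ => hD.eigenvalues_nonneg i) fun i _ => by
          linarith [Real.add_one_le_exp (hD.1.eigenvalues i - 1)]
    _ = Real.exp (∑ i, hD.1.eigenvalues i - Fintype.card ι) := by
        rw [← Real.exp_sum]; simp [Finset.sum_sub_distrib]

end MatrixGaussian

/-! ### Perturbation estimates -/

section Perturbation

variable {E : Type*} [NormedAddCommGroup E] [InnerProductSpace ℝ E]

theorem exists_inverse_one_sub_sq [CompleteSpace E] {T : E →L[ℝ] E} {τ : ℝ} (hτ : 0 ≤ τ)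
    (hτ2 : τ ≤ 1 / 2) (hT : ∀ z, ‖T z‖ ≤ τ * ‖z‖) :
    ∃ N : E →L[ℝ] E, N * (1 - T * T) = 1 ∧ (1 - T * T) * N = 1 := by
  have h1 : ‖T‖ ≤ τ := T.opNorm_le_bound hτ hT
  have h2 : ‖T * T‖ < 1 := by
    refine (norm_mul_le T T).trans_lt ?_
    nlinarith [norm_nonneg T]
  exact ⟨↑(Units.oneSub _ h2)⁻¹, (Units.oneSub _ h2).inv_mul, (Units.oneSub _ h2).mul_inv⟩

variable {T N : E →L[ℝ] E} {τ : ℝ}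

theorem norm_inverse_one_sub_sq_apply_le (hτ : 0 ≤ τ) (hτ2 : τ ≤ 1 / 2)
    (hT : ∀ z, ‖T z‖ ≤ τ * ‖z‖) (hN : ∀ z, N z = z + T (T (N z))) (z : E) :
    ‖N z‖ ≤ 4 / 3 * ‖z‖ := by
  have h1 : ‖N z‖ ≤ ‖z‖ + ‖T (T (N z))‖ := by
    conv_lhs => rw [hN z]
    exact norm_add_le _ _
  have h2 : ‖T (T (N z))‖ ≤ τ * (τ * ‖N z‖) := (hT _).trans (by gcongr; exact hT _)
  have h3 : τ * (τ * ‖N z‖) ≤ 1 / 2 * (1 / 2 * ‖N z‖) := by gcongr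
  linarith

/-- For `N = (1 - T²)⁻¹`, the form `⟪z, (N - 1) z⟫` agrees with `‖T z‖²` to fourth order in `T`. -/
theorem abs_even_part_sub_le (hτ : 0 ≤ τ) (hτ2 : τ ≤ 1 / 2) (hT : ∀ z, ‖T z‖ ≤ τ * ‖z‖)
    (hsym : ∀ x y, ⟪T x, y⟫ = ⟪x, T y⟫) (hN : ∀ z, N z = z + T (T (N z))) (z : E) :
    |(⟪z, N z⟫ - ‖z‖ ^ 2) / 2 - ‖T z‖ ^ 2 / 2| ≤ 2 / 3 * τ ^ 4 * ‖z‖ ^ 2 := by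
  have h1 : N z = z + T (T z) + T (T (T (T (N z)))) := by
    conv_lhs => rw [hN z, hN z]
    simp only [map_add, add_assoc]
  have h2 : (⟪z, N z⟫ - ‖z‖ ^ 2) / 2 - ‖T z‖ ^ 2 / 2 = ⟪z, T (T (T (T (N z))))⟫ / 2 := by
    conv_lhs => rw [h1]
    rw [inner_add_right, inner_add_right, ← hsym z (T z), real_inner_self_eq_norm_sq,
      real_inner_self_eq_norm_sq]
    ring
  have h4 (w : E) : ‖T (T w)‖ ≤ τ * (τ * ‖w‖) := (hT _).trans (by gcongr; exact hT _)
  have h3 : |⟪z, T (T (T (T (N z))))⟫| ≤ ‖z‖ * (τ * (τ * (τ * (τ * (4 / 3 * ‖z‖))))) := by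
    refine (abs_real_inner_le_norm _ _).trans ?_
    gcongr
    refine (h4 _).trans ?_
    gcongr
    refine (h4 _).trans ?_
    gcongr
    exact norm_inverse_one_sub_sq_apply_le hτ hτ2 hT hN z
  rw [h2, abs_div, abs_two]
  nlinarith

/-- For `N = (1 - T²)⁻¹`, the form `⟪z, N T z⟫` agrees with `⟪z, T z⟫` to third order in `T`. -/
theorem abs_odd_part_sub_le (hτ : 0 ≤ τ) (hτ2 : τ ≤ 1 / 2) (hT : ∀ z, ‖T z‖ ≤ τ * ‖z‖)
    (hN : ∀ z, N z = z + T (T (N z))) (z : E) :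
    |⟪z, N (T z)⟫ / 2 - ⟪z, T z⟫ / 2| ≤ 2 / 3 * τ ^ 3 * ‖z‖ ^ 2 := by
  have h2 : ⟪z, N (T z)⟫ / 2 - ⟪z, T z⟫ / 2 = ⟪z, T (T (N (T z)))⟫ / 2 := by
    conv_lhs => rw [hN (T z)]
    rw [inner_add_right]
    ring
  have h3 : |⟪z, T (T (N (T z)))⟫| ≤ ‖z‖ * (τ * (τ * (4 / 3 * (τ * ‖z‖)))) := by
    refine (abs_real_inner_le_norm _ _).trans ?_
    gcongr
    refine (hT _).trans ?_
    gcongr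
    refine (hT _).trans ?_
    gcongr
    refine (norm_inverse_one_sub_sq_apply_le hτ hτ2 hT hN _).trans ?_
    gcongr
    exact hT z
  rw [h2, abs_div, abs_two]
  nlinarith

/-- Second-order lower bound for the symmetrised Gaussian density. Here `τ` is the size of the
correlation, `r` stands for `‖z‖²`, and `a₀`, `b₀` are the leading terms of `a`, `b`. -/
theorem exp_mul_cosh_lower_bound {τ r a b a₀ b₀ : ℝ} (hτ : 0 ≤ τ) (hτ2 : τ ≤ 1 / 2) (hr : 0 ≤ r)
    (ha₀ : 0 ≤ a₀) (ha₀' : a₀ ≤ τ ^ 2 * r / 2) (ha : |a - a₀| ≤ 2 / 3 * τ ^ 4 * r)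
    (hb₀ : |b₀| ≤ τ * r / 2) (hb : |b - b₀| ≤ 2 / 3 * τ ^ 3 * r) :
    1 + (τ ^ 2 - 2 * a₀ + b₀ ^ 2) / 2 - 2 * τ ^ 4 * (1 + r) ^ 3
      ≤ Real.exp (τ ^ 2 / 2) * (Real.exp (-a) * Real.cosh b) := by
  have hτ4 : τ ^ 2 ≤ 1 / 4 := by nlinarith
  have step1 : (1 + τ ^ 2 / 2 - a) * (1 + b ^ 2 / 2)
      ≤ Real.exp (τ ^ 2 / 2) * (Real.exp (-a) * Real.cosh b) := by
    have h1 : 1 + τ ^ 2 / 2 - a ≤ Real.exp (τ ^ 2 / 2 - a) := by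
      linarith [Real.add_one_le_exp (τ ^ 2 / 2 - a)]
    -- `cosh b = 1 + 2 sinh² (b / 2)` and `|sinh u| ≥ |u|`.
    have h2 : 1 + b ^ 2 / 2 ≤ Real.cosh b := by
      have e : Real.cosh b = 2 * Real.sinh (b / 2) ^ 2 + 1 := by
        have := Real.cosh_two_mul (b / 2)
        rw [Real.cosh_sq, mul_div_cancel₀ b two_ne_zero] at this
        linarith
      have hs : (b / 2) ^ 2 ≤ Real.sinh (b / 2) ^ 2 := by
        rw [sq_le_sq, Real.abs_sinh]
        exact Real.self_le_sinh_iff.2 (abs_nonneg _)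
      nlinarith
    rw [← mul_assoc, ← Real.exp_add, ← sub_eq_add_neg]
    exact mul_le_mul h1 h2 (by positivity) (Real.exp_pos _).le
  refine le_trans ?_ step1
  have hbsq : b₀ ^ 2 - 2 / 3 * τ ^ 4 * r ^ 2 ≤ b ^ 2 := by
    have h1 : |b₀| * |b - b₀| ≤ (τ * r / 2) * (2 / 3 * τ ^ 3 * r) := by gcongr
    have h2 : -(|b₀| * |b - b₀|) ≤ b₀ * (b - b₀) := by rw [← abs_mul]; exact neg_abs_le _
    nlinarith [sq_nonneg (b - b₀)]
  have hbup : b ^ 2 ≤ τ ^ 2 * r ^ 2 := by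
    have h1 : |b| ≤ τ * r := by
      have h2 : |b| ≤ |b - b₀| + |b₀| := by simpa using abs_add_le (b - b₀) b₀
      have h3 : 2 / 3 * τ ^ 3 * r ≤ 1 / 6 * (τ * r) := by
        have : 0 ≤ (τ * r) * (1 / 4 - τ ^ 2) := by
          apply mul_nonneg (by positivity); linarith
        nlinarith
      have : 0 ≤ τ * r := by positivity
      linarith
    rw [← sq_abs, ← mul_pow]
    gcongr
  have haup : |τ ^ 2 / 2 - a| ≤ τ ^ 2 * (1 + r) := by
    obtain ⟨h1, h2⟩ := abs_le.1 ha
    have h3 : 2 / 3 * τ ^ 4 * r ≤ 1 / 6 * (τ ^ 2 * r) := by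
      have : 0 ≤ (τ ^ 2 * r) * (1 / 4 - τ ^ 2) := by
        apply mul_nonneg (by positivity); linarith
      nlinarith
    have : 0 ≤ τ ^ 2 * r := by positivity
    rw [abs_le]
    constructor <;> nlinarith [sq_nonneg τ]
  have hcross : -(τ ^ 4 * r ^ 2 * (1 + r)) ≤ (τ ^ 2 / 2 - a) * b ^ 2 := by
    have h1 : |(τ ^ 2 / 2 - a) * b ^ 2| ≤ (τ ^ 2 * (1 + r)) * (τ ^ 2 * r ^ 2) := by
      rw [abs_mul, abs_of_nonneg (sq_nonneg b)]
      gcongr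
    have := neg_abs_le ((τ ^ 2 / 2 - a) * b ^ 2)
    nlinarith
  have hae : -(2 / 3 * τ ^ 4 * r) ≤ a₀ - a := by linarith [(abs_le.1 ha).2]
  have hfin : 2 / 3 * τ ^ 4 * r + 1 / 3 * τ ^ 4 * r ^ 2 + τ ^ 4 * r ^ 2 * (1 + r) / 2
      ≤ 2 * τ ^ 4 * (1 + r) ^ 3 := by
    have h4 : 0 ≤ τ ^ 4 := by positivity
    have h5 : 0 ≤ 2 * (1 + r) ^ 3 - (2 / 3 * r + 1 / 3 * r ^ 2 + r ^ 2 * (1 + r) / 2) := by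
      ring_nf; positivity
    nlinarith [mul_nonneg h4 h5]
  nlinarith

end Perturbation

/-! ### Lower bound for the measure of a product set -/

section Blocks

variable {k : ℕ}

theorem measurableSet_prodSet {F G : Set (EuclideanSpace ℝ (Fin k))} (hF : MeasurableSet F)
    (hG : MeasurableSet G) : MeasurableSet (prodSet F G) := by
  have h1 : Measurable fun z : EuclideanSpace ℝ (Fin k ⊕ Fin k) =>
      WithLp.toLp 2 fun i => z (Sum.inl i) := by fun_prop
  have h2 : Measurable fun z : EuclideanSpace ℝ (Fin k ⊕ Fin k) =>
      WithLp.toLp 2 fun i => z (Sum.inr i) := by fun_prop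
  exact (h1 hF).inter (h2 hG)

/-- The image of a block Gaussian measure under `(x, y) ↦ (M x, N y)`, evaluated on a
product set. -/
theorem blockGaussian_conj_prodSet {A C B : Matrix (Fin k) (Fin k) ℝ}
    (h : (fromBlocks A B Bᵀ C).PosSemidef) (M N : Matrix (Fin k) (Fin k) ℝ)
    {F G : Set (EuclideanSpace ℝ (Fin k))} (hF : MeasurableSet F) (hG : MeasurableSet G) :
    blockGaussian (M * A * Mᵀ) (N * C * Nᵀ) (M * B * Nᵀ) (prodSet F G)
      = blockGaussian A C B (prodSet (toEuclideanCLM (𝕜 := ℝ) M ⁻¹' F)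
          (toEuclideanCLM (𝕜 := ℝ) N ⁻¹' G)) := by
  have e : fromBlocks (M * A * Mᵀ) (M * B * Nᵀ) (M * B * Nᵀ)ᵀ (N * C * Nᵀ)
      = fromBlocks M 0 0 N * fromBlocks A B Bᵀ C * (fromBlocks M 0 0 N)ᵀ := by
    simp [fromBlocks_multiply, fromBlocks_transpose, Matrix.mul_assoc]
  rw [blockGaussian, e, ← multivariateGaussian_map h,
    Measure.map_apply (by fun_prop) (measurableSet_prodSet hF hG), blockGaussian]
  congr 1
  ext z
  have h1 : (fun i => (toEuclideanCLM (𝕜 := ℝ) (fromBlocks M 0 0 N) z) (Sum.inl i))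
      = M *ᵥ fun i => z (Sum.inl i) := by
    ext i
    rw [ofLp_toEuclideanCLM, fromBlocks_mulVec]
    simp [Function.comp_def]
  have h2 : (fun i => (toEuclideanCLM (𝕜 := ℝ) (fromBlocks M 0 0 N) z) (Sum.inr i))
      = N *ᵥ fun i => z (Sum.inr i) := by
    ext i
    rw [ofLp_toEuclideanCLM, fromBlocks_mulVec]
    simp [Function.comp_def]
  simp only [prodSet, Set.mem_preimage, Set.mem_ofPred_eq, h1, h2, toEuclideanCLM_toLp]

/-- The squared Frobenius norm of a real matrix. -/
noncomputable def frobSq (B : Matrix (Fin k) (Fin k) ℝ) : ℝ := ∑ i, ∑ j, B i j ^ 2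

theorem frobSq_nonneg (B : Matrix (Fin k) (Fin k) ℝ) : 0 ≤ frobSq B := by
  unfold frobSq; positivity

theorem frobSq_transpose (B : Matrix (Fin k) (Fin k) ℝ) : frobSq Bᵀ = frobSq B := by
  unfold frobSq; exact Finset.sum_comm

theorem frobSq_neg (B : Matrix (Fin k) (Fin k) ℝ) : frobSq (-B) = frobSq B := by
  simp [frobSq]

theorem continuous_frobSq : Continuous (frobSq (k := k)) := by
  unfold frobSq; fun_prop

theorem sum_mulVec_sq_le (B : Matrix (Fin k) (Fin k) ℝ) (y : Fin k → ℝ) :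
    ∑ i, (B *ᵥ y) i ^ 2 ≤ frobSq B * ∑ j, y j ^ 2 := by
  rw [frobSq, Finset.sum_mul]
  exact Finset.sum_le_sum fun i _ => Finset.sum_mul_sq_le_sq_mul_sq Finset.univ (B i) y

/-- The operator with matrix `[[0, B], [Bᵀ, 0]]`, the off-diagonal part of the covariance. -/
noncomputable def crossOp (B : Matrix (Fin k) (Fin k) ℝ) :
    EuclideanSpace ℝ (Fin k ⊕ Fin k) →L[ℝ] EuclideanSpace ℝ (Fin k ⊕ Fin k) :=
  toEuclideanCLM (𝕜 := ℝ) (fromBlocks 0 B Bᵀ 0)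

theorem crossOp_neg (B : Matrix (Fin k) (Fin k) ℝ) : crossOp (-B) = -crossOp B := by
  have : fromBlocks 0 (-B) (-B)ᵀ 0 = -fromBlocks 0 B Bᵀ 0 := by simp [fromBlocks_neg]
  rw [crossOp, this, map_neg, crossOp]

theorem toEuclideanCLM_fromBlocks_one (B : Matrix (Fin k) (Fin k) ℝ) :
    toEuclideanCLM (𝕜 := ℝ) (fromBlocks 1 B Bᵀ 1) = 1 + crossOp B := by
  have : fromBlocks 1 B Bᵀ 1 = 1 + fromBlocks 0 B Bᵀ 0 := by
    rw [← fromBlocks_one, fromBlocks_add]; simp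
  rw [this, map_add, map_one, crossOp]

theorem norm_sq_eq_inl_add_inr (z : EuclideanSpace ℝ (Fin k ⊕ Fin k)) :
    ‖z‖ ^ 2 = ∑ i, z (Sum.inl i) ^ 2 + ∑ j, z (Sum.inr j) ^ 2 := by
  simp [EuclideanSpace.real_norm_sq_eq, Fintype.sum_sum_type]

theorem norm_crossOp_sq (B : Matrix (Fin k) (Fin k) ℝ) (z : EuclideanSpace ℝ (Fin k ⊕ Fin k)) :
    ‖crossOp B z‖ ^ 2 = ∑ i, (B *ᵥ fun j => z (Sum.inr j)) i ^ 2
      + ∑ j, (Bᵀ *ᵥ fun i => z (Sum.inl i)) j ^ 2 := by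
  rw [norm_sq_eq_inl_add_inr, crossOp, ofLp_toEuclideanCLM, fromBlocks_mulVec]
  simp [Function.comp_def]

theorem norm_crossOp_le (B : Matrix (Fin k) (Fin k) ℝ) (z : EuclideanSpace ℝ (Fin k ⊕ Fin k)) :
    ‖crossOp B z‖ ≤ √(frobSq B) * ‖z‖ := by
  refine (pow_le_pow_iff_left₀ (norm_nonneg _) (by positivity) two_ne_zero).1 ?_
  rw [mul_pow, Real.sq_sqrt (frobSq_nonneg B), norm_crossOp_sq, norm_sq_eq_inl_add_inr]
  have h1 := sum_mulVec_sq_le B fun j => z (Sum.inr j)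
  have h2 := sum_mulVec_sq_le Bᵀ fun i => z (Sum.inl i)
  rw [frobSq_transpose] at h2
  linarith

theorem inner_crossOp (B : Matrix (Fin k) (Fin k) ℝ) (z : EuclideanSpace ℝ (Fin k ⊕ Fin k)) :
    ⟪z, crossOp B z⟫ / 2 = (fun i => z (Sum.inl i)) ⬝ᵥ B *ᵥ fun j => z (Sum.inr j) := by
  set x := fun i => z (Sum.inl i) with hx
  set y := fun i => z (Sum.inr i) with hy
  have hz : (z.ofLp) = Sum.elim x y := by ext (i | i) <;> rfl
  rw [crossOp, inner_toEuclideanCLM, hz, fromBlocks_mulVec, sumElim_dotProduct_sumElim]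
  simp only [Sum.elim_comp_inl, Sum.elim_comp_inr, zero_mulVec, zero_add, add_zero]
  rw [mulVec_transpose, ← dotProduct_comm (x ᵥ* B), ← dotProduct_mulVec]
  ring

theorem crossOp_symm (B : Matrix (Fin k) (Fin k) ℝ) (x y : EuclideanSpace ℝ (Fin k ⊕ Fin k)) :
    ⟪crossOp B x, y⟫ = ⟪x, crossOp B y⟫ := by
  have hs : (fromBlocks 0 B Bᵀ 0)ᵀ = fromBlocks 0 B Bᵀ 0 := by simp [fromBlocks_transpose]
  rw [real_inner_comm, crossOp, inner_toEuclideanCLM, inner_toEuclideanCLM, dotProduct_mulVec,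
    dotProduct_comm, ← mulVec_transpose, hs]

theorem posDef_fromBlocks_one {B : Matrix (Fin k) (Fin k) ℝ} (hB : frobSq B < 1) :
    (fromBlocks 1 B Bᵀ 1).PosDef := by
  refine PosDef.of_dotProduct_mulVec_pos ?_ fun x hx => ?_
  · rw [IsHermitian, conjTranspose_eq_transpose_of_trivial]
    simp [fromBlocks_transpose]
  · set z : EuclideanSpace ℝ (Fin k ⊕ Fin k) := WithLp.toLp 2 x with hz
    have h1 : star x ⬝ᵥ fromBlocks 1 B Bᵀ 1 *ᵥ x = ‖z‖ ^ 2 + ⟪z, crossOp B z⟫ := by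
      rw [← real_inner_self_eq_norm_sq, ← inner_add_right]
      have := inner_toEuclideanCLM (fromBlocks 1 B Bᵀ 1) z z
      rw [toEuclideanCLM_fromBlocks_one] at this
      simpa using this.symm
    have hz0 : 0 < ‖z‖ := norm_pos_iff.2 fun h => hx (by simpa [hz] using h)
    have h2 : √(frobSq B) < 1 := by
      rw [Real.sqrt_lt' one_pos]; simpa using hB
    have h3 : |⟪z, crossOp B z⟫| ≤ ‖z‖ * (√(frobSq B) * ‖z‖) :=
      (abs_real_inner_le_norm _ _).trans (by gcongr; exact norm_crossOp_le B z)
    rw [h1]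
    have h4 : ‖z‖ * (√(frobSq B) * ‖z‖) < ‖z‖ ^ 2 := by
      have : 0 < ‖z‖ ^ 2 * (1 - √(frobSq B)) := mul_pos (by positivity) (by linarith)
      nlinarith
    linarith [neg_abs_le ⟪z, crossOp B z⟫]

/-- The determinant equals `det (1 - Bᵀ B)`, and `1 - Bᵀ B` is positive semidefinite as a Schur
complement. -/
theorem det_fromBlocks_one_le {B : Matrix (Fin k) (Fin k) ℝ} (hB : frobSq B < 1) :
    (fromBlocks 1 B Bᵀ 1).det ≤ Real.exp (-frobSq B) := by
  have h1 : (1 - Bᵀ * B).PosSemidef := by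
    -- Schur complement of the upper left block of the positive semidefinite matrix `1 + K`.
    have h := (posDef_fromBlocks_one hB).posSemidef
    have : Bᵀ = Bᴴ := (conjTranspose_eq_transpose_of_trivial B).symm
    rw [this] at h ⊢
    have : Invertible (1 : Matrix (Fin k) (Fin k) ℝ) := invertibleOne
    simpa using (PosDef.fromBlocks₁₁ (m := Fin k) (n := Fin k) B 1 PosDef.one).1 h
  rw [det_fromBlocks_one₁₁]
  refine h1.det_le_exp_trace_sub.trans (Real.exp_le_exp.2 (le_of_eq ?_))
  rw [trace_sub, trace_one, frobSq]
  have : (Bᵀ * B).trace = ∑ i, ∑ j, B i j ^ 2 := by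
    rw [Finset.sum_comm]
    simp [Matrix.trace, Matrix.mul_apply, sq]
  rw [this]
  ring

theorem blockGaussian_neg_prodSet {B : Matrix (Fin k) (Fin k) ℝ} (hB : frobSq B < 1)
    {F G : Set (EuclideanSpace ℝ (Fin k))} (hF : MeasurableSet F) (hG : MeasurableSet G)
    (hFs : ∀ x ∈ F, -x ∈ F) :
    blockGaussian 1 1 (-B) (prodSet F G) = blockGaussian 1 1 B (prodSet F G) := by
  have h := blockGaussian_conj_prodSet (posDef_fromBlocks_one hB).posSemidef (-1) 1 hF hG
  have hpre : toEuclideanCLM (𝕜 := ℝ) (-1 : Matrix (Fin k) (Fin k) ℝ) ⁻¹' F = F := by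
    ext x
    simp only [map_neg, map_one, Set.mem_preimage, _root_.neg_apply]
    exact ⟨fun h => by simpa using hFs _ h, hFs x⟩
  rw [hpre] at h
  simpa using h

theorem integrable_of_real_withDensity {α : Type*} [MeasurableSpace α] {μ : Measure α} {d : α → ℝ}
    (hd : Measurable d) (hd0 : ∀ x, 0 ≤ d x)
    [IsFiniteMeasure (μ.withDensity fun x => ENNReal.ofReal (d x))] : Integrable d μ := by
  refine ⟨hd.aestronglyMeasurable, ?_⟩
  rw [hasFiniteIntegral_iff_ofReal (.of_forall hd0)]
  have := measure_lt_top (μ.withDensity fun x => ENNReal.ofReal (d x)) Set.univ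
  rwa [withDensity_apply _ MeasurableSet.univ, Measure.restrict_univ] at this

theorem real_withDensity_eq_setIntegral {α : Type*} [MeasurableSpace α] {μ : Measure α} {d : α → ℝ}
    (hd : Measurable d) (hd0 : ∀ x, 0 ≤ d x) {S : Set α} (hS : MeasurableSet S) :
    (μ.withDensity fun x => ENNReal.ofReal (d x)).real S = ∫ x in S, d x ∂μ := by
  rw [measureReal_def, withDensity_apply _ hS,
    integral_eq_lintegral_of_nonneg_ae (.of_forall hd0) hd.aestronglyMeasurable]

/-- The second-order approximation of the density of `blockGaussian 1 1 B`, symmetrised under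
`B ↦ -B`, with respect to the standard Gaussian measure. -/
noncomputable def quadDensity (B : Matrix (Fin k) (Fin k) ℝ)
    (z : EuclideanSpace ℝ (Fin k ⊕ Fin k)) : ℝ :=
  1 + (frobSq B - ‖crossOp B z‖ ^ 2 + (⟪z, crossOp B z⟫ / 2) ^ 2) / 2

theorem integrable_one_add_norm_sq_pow :
    Integrable (fun z : EuclideanSpace ℝ (Fin k ⊕ Fin k) => (1 + ‖z‖ ^ 2) ^ 3)
      (stdGaussian _) := by
  have h (n : ℕ) : Integrable (fun z : EuclideanSpace ℝ (Fin k ⊕ Fin k) => ‖z‖ ^ n)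
      (stdGaussian _) :=
    (IsGaussian.memLp_id (stdGaussian (EuclideanSpace ℝ (Fin k ⊕ Fin k))) n
      (by simp)).integrable_norm_pow'
  have : (fun z : EuclideanSpace ℝ (Fin k ⊕ Fin k) => (1 + ‖z‖ ^ 2) ^ 3)
      = fun z => 1 + 3 * ‖z‖ ^ 2 + 3 * ‖z‖ ^ 4 + ‖z‖ ^ 6 := by ext z; ring
  rw [this]
  exact (((integrable_const _).add ((h 2).const_mul 3)).add ((h 4).const_mul 3)).add (h 6)

theorem integrable_quadDensity {B : Matrix (Fin k) (Fin k) ℝ} (hB : frobSq B ≤ 1) :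
    Integrable (quadDensity B) (stdGaussian _) := by
  refine (integrable_one_add_norm_sq_pow.const_mul 2).mono' ?_ (.of_forall fun z => ?_)
  · have : Measurable (quadDensity B) := by unfold quadDensity; fun_prop
    exact this.aestronglyMeasurable
  · have h1 : √(frobSq B) ≤ 1 := by simpa using Real.sqrt_le_sqrt hB
    have h2 : ‖crossOp B z‖ ≤ ‖z‖ :=
      (norm_crossOp_le B z).trans (mul_le_of_le_one_left (norm_nonneg _) h1)
    have h3 : |⟪z, crossOp B z⟫| ≤ ‖z‖ ^ 2 :=
      (abs_real_inner_le_norm _ _).trans (by rw [sq]; gcongr)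
    have h4 : ‖crossOp B z‖ ^ 2 ≤ ‖z‖ ^ 2 := by gcongr
    have h5 : ⟪z, crossOp B z⟫ ^ 2 ≤ (‖z‖ ^ 2) ^ 2 := by rw [← sq_abs]; gcongr
    have h6 := frobSq_nonneg B
    rw [quadDensity, Real.norm_eq_abs, abs_le]
    constructor <;>
      nlinarith [sq_nonneg ‖z‖, sq_nonneg ‖crossOp B z‖, sq_nonneg ⟪z, crossOp B z⟫,
        pow_nonneg (sq_nonneg ‖z‖) 3, pow_nonneg (sq_nonneg ‖z‖) 2]

theorem inv_fromBlocks_one {B : Matrix (Fin k) (Fin k) ℝ} (hB : frobSq B < 1)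
    {N : EuclideanSpace ℝ (Fin k ⊕ Fin k) →L[ℝ] EuclideanSpace ℝ (Fin k ⊕ Fin k)}
    (hN : N * (1 - crossOp B * crossOp B) = 1) :
    toEuclideanCLM (𝕜 := ℝ) (fromBlocks 1 B Bᵀ 1)⁻¹ = N * (1 - crossOp B) := by
  have hu : IsUnit (fromBlocks 1 B Bᵀ 1).det :=
    isUnit_iff_ne_zero.2 (posDef_fromBlocks_one hB).det_pos.ne'
  have h1 : (1 + crossOp B) * toEuclideanCLM (𝕜 := ℝ) (fromBlocks 1 B Bᵀ 1)⁻¹ = 1 := by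
    rw [← toEuclideanCLM_fromBlocks_one, ← map_mul, mul_nonsing_inv _ hu, map_one]
  have h2 : N * (1 - crossOp B) * (1 + crossOp B) = 1 := by
    have : (1 - crossOp B) * (1 + crossOp B) = 1 - crossOp B * crossOp B := by
      rw [_root_.sub_mul, _root_.one_mul, _root_.mul_add, _root_.mul_one]; abel
    rw [mul_assoc, this, hN]
  exact (left_inv_eq_right_inv h2 h1).symm

/-- The second-order lower bound for `μ_B(F × G)`, with an error of fourth order in `B`. Averaging
the densities of `μ_B` and `μ_{-B}` turns the exponential of the cross term into a hyperbolic
cosine. -/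
theorem le_blockGaussian_real_prodSet {B : Matrix (Fin k) (Fin k) ℝ} (hB : frobSq B ≤ 1 / 4)
    {F G : Set (EuclideanSpace ℝ (Fin k))} (hF : MeasurableSet F) (hG : MeasurableSet G)
    (hFs : ∀ x ∈ F, -x ∈ F) :
    (∫ z in prodSet F G, quadDensity B z ∂(stdGaussian _))
      - 2 * frobSq B ^ 2 *
        ∫ z : EuclideanSpace ℝ (Fin k ⊕ Fin k), (1 + ‖z‖ ^ 2) ^ 3 ∂(stdGaussian _)
      ≤ (blockGaussian 1 1 B).real (prodSet F G) := by
  set q := frobSq B with hq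
  have hq0 : 0 ≤ q := frobSq_nonneg B
  have hB1 : frobSq B < 1 := by linarith
  have hB1' : frobSq (-B) < 1 := by rwa [frobSq_neg]
  set τ := √q with hτ
  have hτq : τ ^ 2 = q := Real.sq_sqrt hq0
  have hτ0 : 0 ≤ τ := Real.sqrt_nonneg _
  have hτ2 : τ ≤ 1 / 2 := by
    rw [hτ, Real.sqrt_le_left (by norm_num)]; linarith
  set T := crossOp B with hT
  have hTle : ∀ z, ‖T z‖ ≤ τ * ‖z‖ := norm_crossOp_le B
  obtain ⟨N, hN1, hN2⟩ := exists_inverse_one_sub_sq hτ0 hτ2 hTle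
  have hNz (z) : N z = z + T (T (N z)) := by
    have := congrArg (fun L => L z) hN2
    simp only [sub_mul, one_mul, _root_.sub_apply, one_apply_eq_self,
      ContinuousLinearMap.mul_def, ContinuousLinearMap.comp_apply] at this
    rw [← sub_eq_iff_eq_add]
    exact this
  have hSm : MeasurableSet (prodSet F G) := measurableSet_prodSet hF hG
  let dens (B' : Matrix (Fin k) (Fin k) ℝ) (z : EuclideanSpace ℝ (Fin k ⊕ Fin k)) : ℝ :=
    (√(fromBlocks 1 B' B'ᵀ 1).det)⁻¹ *
      Real.exp ((‖z‖ ^ 2 - ⟪z, toEuclideanCLM (𝕜 := ℝ) (fromBlocks 1 B' B'ᵀ 1)⁻¹ z⟫) / 2)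
  have hdm (B') : Measurable (dens B') := by fun_prop
  have hd0 (B') (z) : 0 ≤ dens B' z := by positivity
  have hmeas (B') (hB' : frobSq B' < 1) : blockGaussian 1 1 B'
      = (stdGaussian _).withDensity fun z => ENNReal.ofReal (dens B' z) :=
    multivariateGaussian_eq_withDensity (posDef_fromBlocks_one hB')
  have hint (B') (hB' : frobSq B' < 1) : Integrable (dens B') (stdGaussian _) := by
    have : IsFiniteMeasure ((stdGaussian _).withDensity fun z => ENNReal.ofReal (dens B' z)) := by
      rw [← hmeas B' hB', blockGaussian]; infer_instance
    exact integrable_of_real_withDensity (hdm B') (hd0 B')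
  have hreal (B') (hB' : frobSq B' < 1) : (blockGaussian 1 1 B').real (prodSet F G)
      = ∫ z in prodSet F G, dens B' z ∂(stdGaussian _) := by
    rw [hmeas B' hB', real_withDensity_eq_setIntegral (hdm B') (hd0 B') hSm]
  have hdet (B' : Matrix (Fin k) (Fin k) ℝ) (hB' : frobSq B' = q) :
      Real.exp (q / 2) ≤ (√(fromBlocks 1 B' B'ᵀ 1).det)⁻¹ := by
    have hlt : frobSq B' < 1 := by rw [hB']; exact hB1
    have hpos := (posDef_fromBlocks_one hlt).det_pos
    rw [le_inv_comm₀ (Real.exp_pos _) (Real.sqrt_pos.2 hpos), ← Real.exp_neg,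
      Real.sqrt_le_left (Real.exp_pos _).le, ← Real.exp_nat_mul]
    refine (det_fromBlocks_one_le hlt).trans (Real.exp_le_exp.2 (le_of_eq ?_))
    rw [hB']; push_cast; ring
  -- The pointwise bound for the sum of the two densities.
  have hsum (z) : 2 * (quadDensity B z - 2 * q ^ 2 * (1 + ‖z‖ ^ 2) ^ 3)
      ≤ dens B z + dens (-B) z := by
    set a := (⟪z, N z⟫ - ‖z‖ ^ 2) / 2 with ha
    set b := ⟪z, N (T z)⟫ / 2 with hb
    have e1 : Real.exp (q / 2) * Real.exp (-a + b) ≤ dens B z := by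
      refine mul_le_mul (hdet B rfl) (Real.exp_le_exp.2 (le_of_eq ?_)) (Real.exp_pos _).le
        (by positivity)
      rw [inv_fromBlocks_one hB1 hN1]
      simp only [ContinuousLinearMap.mul_def, ContinuousLinearMap.comp_apply,
        _root_.sub_apply, one_apply_eq_self, map_sub, inner_sub_right,
        ha, hb, hT]
      ring
    have hsq : -crossOp B * -crossOp B = crossOp B * crossOp B := by ext x; simp
    have e2 : Real.exp (q / 2) * Real.exp (-a - b) ≤ dens (-B) z := by
      refine mul_le_mul (hdet (-B) (frobSq_neg B)) (Real.exp_le_exp.2 (le_of_eq ?_))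
        (Real.exp_pos _).le (by positivity)
      rw [inv_fromBlocks_one (N := N) hB1' (by rw [crossOp_neg, hsq]; exact hN1)]
      simp only [ContinuousLinearMap.mul_def, ContinuousLinearMap.comp_apply, crossOp_neg,
        _root_.sub_apply, one_apply_eq_self, map_sub, inner_sub_right,
        _root_.neg_apply, map_neg, inner_neg_right, ha, hb, hT]
      ring
    have key := exp_mul_cosh_lower_bound (a := a) (b := b) (a₀ := ‖T z‖ ^ 2 / 2)
      (b₀ := ⟪z, T z⟫ / 2) (r := ‖z‖ ^ 2) hτ0 hτ2 (by positivity) (by positivity) ?_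
      (abs_even_part_sub_le hτ0 hτ2 hTle (crossOp_symm B) hNz z) ?_
      (abs_odd_part_sub_le hτ0 hτ2 hTle hNz z)
    · have e3 : τ ^ 4 = q ^ 2 := by rw [← hτq]; ring
      have e4 : Real.exp (-a) * Real.cosh b = (Real.exp (-a + b) + Real.exp (-a - b)) / 2 := by
        rw [Real.cosh_eq, Real.exp_add, sub_eq_add_neg, Real.exp_add]; ring
      rw [e3, e4, hτq] at key
      have e5 : quadDensity B z = 1 + (q - 2 * (‖T z‖ ^ 2 / 2) + (⟪z, T z⟫ / 2) ^ 2) / 2 := by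
        rw [quadDensity]; ring
      rw [e5]
      nlinarith
    · have : ‖T z‖ ^ 2 ≤ (τ * ‖z‖) ^ 2 := by gcongr; exact hTle z
      rw [mul_pow] at this
      linarith
    · rw [abs_div, abs_two]
      have : |⟪z, T z⟫| ≤ ‖z‖ * (τ * ‖z‖) :=
        (abs_real_inner_le_norm _ _).trans (by gcongr; exact hTle z)
      nlinarith
  have hI1 : Integrable (quadDensity B) (stdGaussian _) := integrable_quadDensity (by linarith)
  have hI2 : Integrable (fun z : EuclideanSpace ℝ (Fin k ⊕ Fin k) =>
      2 * q ^ 2 * (1 + ‖z‖ ^ 2) ^ 3) (stdGaussian _) := integrable_one_add_norm_sq_pow.const_mul _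
  have h1 : ∫ z in prodSet F G, 2 * (quadDensity B z - 2 * q ^ 2 * (1 + ‖z‖ ^ 2) ^ 3)
      ∂(stdGaussian _) ≤ ∫ z in prodSet F G, (dens B z + dens (-B) z) ∂(stdGaussian _) :=
    integral_mono ((hI1.sub hI2).const_mul 2).integrableOn
      ((hint B hB1).add (hint (-B) hB1')).integrableOn hsum
  rw [integral_add (hint B hB1).integrableOn (hint (-B) hB1').integrableOn, ← hreal B hB1,
    ← hreal (-B) hB1', measureReal_def (blockGaussian 1 1 (-B)),
    blockGaussian_neg_prodSet hB1 hF hG hFs, ← measureReal_def, integral_const_mul,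
    integral_sub hI1.integrableOn hI2.integrableOn] at h1
  have h2 : ∫ z in prodSet F G, 2 * q ^ 2 * (1 + ‖z‖ ^ 2) ^ 3 ∂(stdGaussian _)
      ≤ 2 * q ^ 2 *
        ∫ z : EuclideanSpace ℝ (Fin k ⊕ Fin k), (1 + ‖z‖ ^ 2) ^ 3 ∂(stdGaussian _) :=
    (setIntegral_le_integral hI2 (.of_forall fun z => by positivity)).trans
      (integral_const_mul _ _).le
  linarith

end Blocks

/-! ### The second-order term -/

section Hessian

variable {k : ℕ}

/-- The point of `ℝ^{2k}` with first half `p.1` and second half `p.2`. -/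
noncomputable def joinCoords (p : EuclideanSpace ℝ (Fin k) × EuclideanSpace ℝ (Fin k)) :
    EuclideanSpace ℝ (Fin k ⊕ Fin k) :=
  WithLp.toLp 2 (Sum.elim p.1 p.2)

theorem continuous_joinCoords : Continuous (joinCoords (k := k)) := by
  refine (PiLp.continuous_toLp 2 _).comp (continuous_pi fun i => ?_)
  rcases i with i | i
  · exact (EuclideanSpace.proj i).continuous.comp continuous_fst
  · exact (EuclideanSpace.proj i).continuous.comp continuous_snd

theorem joinCoords_mem_prodSet {F G : Set (EuclideanSpace ℝ (Fin k))}
    {p : EuclideanSpace ℝ (Fin k) × EuclideanSpace ℝ (Fin k)} :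
    joinCoords p ∈ prodSet F G ↔ p ∈ F ×ˢ G := by
  simp [prodSet, joinCoords]

theorem exists_joinCoords_eq (z : EuclideanSpace ℝ (Fin k ⊕ Fin k)) : ∃ p, joinCoords p = z :=
  ⟨(WithLp.toLp 2 fun i => z (Sum.inl i), WithLp.toLp 2 fun i => z (Sum.inr i)), by
    ext (i | i) <;> simp [joinCoords]⟩

theorem map_joinCoords_stdGaussian :
    ((stdGaussian (EuclideanSpace ℝ (Fin k))).prod (stdGaussian (EuclideanSpace ℝ (Fin k)))).map
      joinCoords = stdGaussian (EuclideanSpace ℝ (Fin k ⊕ Fin k)) := by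
  apply Measure.ext_of_charFun
  ext t
  obtain ⟨⟨u, v⟩, rfl⟩ := exists_joinCoords_eq t
  rw [charFun_apply, integral_map continuous_joinCoords.aemeasurable (by fun_prop),
    charFun_stdGaussian]
  have h (p : EuclideanSpace ℝ (Fin k) × EuclideanSpace ℝ (Fin k)) :
      Complex.exp (⟪joinCoords p, joinCoords (u, v)⟫ * Complex.I)
      = Complex.exp (⟪p.1, u⟫ * Complex.I) * Complex.exp (⟪p.2, v⟫ * Complex.I) := by
    rw [← Complex.exp_add]
    congr 1
    simp only [joinCoords, PiLp.inner_apply, Fintype.sum_sum_type, Sum.elim_inl, Sum.elim_inr]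
    push_cast
    ring
  simp_rw [h]
  rw [integral_prod_mul (fun x : EuclideanSpace ℝ (Fin k) => Complex.exp (⟪x, u⟫ * Complex.I))
    (fun x : EuclideanSpace ℝ (Fin k) => Complex.exp (⟪x, v⟫ * Complex.I)), ← charFun_apply,
    ← charFun_apply, charFun_stdGaussian, charFun_stdGaussian, ← Complex.exp_add]
  congr 1
  have : ‖joinCoords (u, v)‖ ^ 2 = ‖u‖ ^ 2 + ‖v‖ ^ 2 := by
    simp [joinCoords, EuclideanSpace.real_norm_sq_eq]
  have h3 : ((‖joinCoords (u, v)‖ : ℝ) : ℂ) ^ 2 = (‖u‖ : ℂ) ^ 2 + (‖v‖ : ℂ) ^ 2 := by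
    exact_mod_cast congrArg (fun r : ℝ => (r : ℂ)) this
  rw [h3]
  ring

/-- The matrix `1 - x xᵀ`, minus the Hermite polynomial of degree two at `x`. -/
noncomputable def hermiteMatrix (x : EuclideanSpace ℝ (Fin k)) : Matrix (Fin k) (Fin k) ℝ :=
  1 - vecMulVec x x

theorem frobSq_eq_trace (B : Matrix (Fin k) (Fin k) ℝ) : frobSq B = (B * Bᵀ).trace := by
  simp [frobSq, Matrix.trace, Matrix.mul_apply, sq]

theorem quadDensity_joinCoords (B : Matrix (Fin k) (Fin k) ℝ)
    (p : EuclideanSpace ℝ (Fin k) × EuclideanSpace ℝ (Fin k)) :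
    quadDensity B (joinCoords p)
      = 1 + (hermiteMatrix p.1 * B * hermiteMatrix p.2 * Bᵀ).trace / 2 := by
  obtain ⟨x, y⟩ := p
  have hx : (fun i => joinCoords (x, y) (Sum.inl i)) = x.ofLp := rfl
  have hy : (fun i => joinCoords (x, y) (Sum.inr i)) = y.ofLp := rfl
  rw [quadDensity, inner_crossOp, norm_crossOp_sq, hx, hy, frobSq_eq_trace]
  congr 2
  simp only [hermiteMatrix, Matrix.sub_mul, Matrix.mul_sub, Matrix.one_mul, Matrix.mul_one,
    vecMulVec_mul, mul_vecMulVec, trace_sub, trace_vecMulVec]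
  have h1 : ∑ i, (B *ᵥ y.ofLp) i ^ 2 = B *ᵥ y.ofLp ⬝ᵥ y.ofLp ᵥ* Bᵀ := by
    rw [vecMul_transpose]; simp [dotProduct, sq]
  have h2 : ∑ i, (Bᵀ *ᵥ x.ofLp) i ^ 2 = x.ofLp ⬝ᵥ x.ofLp ᵥ* B ᵥ* Bᵀ := by
    rw [vecMul_transpose, dotProduct_mulVec, ← mulVec_transpose]; simp [dotProduct, sq]
  rw [h1, h2]
  have h3 : y.ofLp ᵥ* Bᵀ = B *ᵥ y.ofLp := vecMul_transpose _ _
  have h4 : x.ofLp ⬝ᵥ B *ᵥ y.ofLp = x.ofLp ᵥ* B ⬝ᵥ y.ofLp := dotProduct_mulVec _ _ _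
  rw [h3, sub_mulVec, vecMulVec_mulVec, sub_dotProduct, op_smul_eq_smul, smul_dotProduct, h4,
    smul_eq_mul]
  ring

theorem trace_mul_four_eq_sum (S T B : Matrix (Fin k) (Fin k) ℝ) :
    (S * B * T * Bᵀ).trace = ∑ i, ∑ m, ∑ p, ∑ r, S i r * T p m * (B r p * B i m) := by
  simp only [Matrix.trace, diag_apply, Matrix.mul_apply, transpose_apply, Finset.sum_mul]
  refine Finset.sum_congr rfl fun i _ => Finset.sum_congr rfl fun m _ =>
    Finset.sum_congr rfl fun p _ => Finset.sum_congr rfl fun r _ => ?_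
  ring

/-- The matrix `∫_F (1 - x xᵀ) dγ(x)`, which measures by how much the Gaussian measure restricted
to `F` has smaller second moments than the Gaussian measure itself. -/
noncomputable def momentDefect (F : Set (EuclideanSpace ℝ (Fin k))) : Matrix (Fin k) (Fin k) ℝ :=
  of fun i j => ∫ x in F, hermiteMatrix x i j ∂(stdGaussian _)

theorem integrable_hermiteMatrix (i j : Fin k) :
    Integrable (fun x : EuclideanSpace ℝ (Fin k) => hermiteMatrix x i j) (stdGaussian _) := by
  have h (i : Fin k) : MemLp (fun x : EuclideanSpace ℝ (Fin k) => x i) 2 (stdGaussian _) :=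
    IsGaussian.memLp_dual (stdGaussian _) (EuclideanSpace.proj i) 2 (by simp)
  exact (integrable_const _).sub ((h i).integrable_mul (h j))

/-- The second-order term of the expansion is a trace form in the moment defects of `F` and `G`. -/
theorem setIntegral_quadDensity {B : Matrix (Fin k) (Fin k) ℝ}
    {F G : Set (EuclideanSpace ℝ (Fin k))} (hF : MeasurableSet F) (hG : MeasurableSet G) :
    ∫ z in prodSet F G, quadDensity B z ∂(stdGaussian _)
      = (stdGaussian _).real (prodSet F G)
        + (momentDefect F * B * momentDefect G * Bᵀ).trace / 2 := by
  have hS := measurableSet_prodSet hF hG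
  have hJ : Measurable (joinCoords (k := k)) := continuous_joinCoords.measurable
  have hq : Measurable (quadDensity B) := by unfold quadDensity; fun_prop
  have hpre : joinCoords ⁻¹' prodSet F G = F ×ˢ G := by
    ext p; exact joinCoords_mem_prodSet
  set γ := stdGaussian (EuclideanSpace ℝ (Fin k))
  have hterm (i m p r : Fin k) : Integrable (fun w : _ × _ =>
      hermiteMatrix w.1 i r * hermiteMatrix w.2 p m * (B r p * B i m))
      ((γ.prod γ).restrict (F ×ˢ G)) :=
    (((integrable_hermiteMatrix i r).mul_prod (integrable_hermiteMatrix p m)).mul_const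
      _).integrableOn
  have hsum : Integrable (fun w : _ × _ => ∑ i, ∑ m, ∑ p, ∑ r,
      hermiteMatrix w.1 i r * hermiteMatrix w.2 p m * (B r p * B i m))
      ((γ.prod γ).restrict (F ×ˢ G)) :=
    integrable_finsetSum _ fun i _ => integrable_finsetSum _ fun m _ =>
      integrable_finsetSum _ fun p _ => integrable_finsetSum _ fun r _ => hterm i m p r
  rw [← map_joinCoords_stdGaussian, setIntegral_map hS hq.aestronglyMeasurable hJ.aemeasurable,
    map_measureReal_apply hJ hS, hpre]
  simp_rw [quadDensity_joinCoords, trace_mul_four_eq_sum]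
  rw [integral_add (integrable_const _) (hsum.div_const 2), integral_div]
  congr 1
  · simp [γ]
  · congr 1
    rw [integral_finsetSum _ fun i _ => integrable_finsetSum _ fun m _ =>
      integrable_finsetSum _ fun p _ => integrable_finsetSum _ fun r _ => hterm i m p r]
    refine Finset.sum_congr rfl fun i _ => ?_
    rw [integral_finsetSum _ fun m _ =>
      integrable_finsetSum _ fun p _ => integrable_finsetSum _ fun r _ => hterm i m p r]
    refine Finset.sum_congr rfl fun m _ => ?_
    rw [integral_finsetSum _ fun p _ => integrable_finsetSum _ fun r _ => hterm i m p r]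
    refine Finset.sum_congr rfl fun p _ => ?_
    rw [integral_finsetSum _ fun r _ => hterm i m p r]
    refine Finset.sum_congr rfl fun r _ => ?_
    rw [integral_mul_const, setIntegral_prod_mul (fun x => hermiteMatrix x i r)
      (fun y => hermiteMatrix y p m)]
    rfl

theorem dotProduct_momentDefect_mulVec (F : Set (EuclideanSpace ℝ (Fin k)))
    (v : EuclideanSpace ℝ (Fin k)) :
    v ⬝ᵥ momentDefect F *ᵥ v = ∫ x in F, (‖v‖ ^ 2 - ⟪v, x⟫ ^ 2) ∂(stdGaussian _) := by
  have h1 (x : EuclideanSpace ℝ (Fin k)) : ‖v‖ ^ 2 - ⟪v, x⟫ ^ 2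
      = ∑ i, ∑ j, hermiteMatrix x i j * (v i * v j) := by
    have h2 : ⟪v, x⟫ = v.ofLp ⬝ᵥ x.ofLp := by
      simp [PiLp.inner_apply, dotProduct, mul_comm]
    have h3 : ‖v‖ ^ 2 = v.ofLp ⬝ᵥ v.ofLp := by
      rw [EuclideanSpace.real_norm_sq_eq]; simp [dotProduct, sq]
    have h4 : ∑ i, ∑ j, hermiteMatrix x i j * (v i * v j)
        = v.ofLp ⬝ᵥ hermiteMatrix x *ᵥ v.ofLp := by
      simp only [dotProduct, mulVec, Finset.mul_sum]
      exact Finset.sum_congr rfl fun i _ => Finset.sum_congr rfl fun j _ => by ring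
    rw [h4, h2, h3, hermiteMatrix, sub_mulVec, one_mulVec, vecMulVec_mulVec, dotProduct_sub,
      dotProduct_smul, dotProduct_comm x.ofLp v.ofLp]
    simp [sq]
  have hint (i j : Fin k) : Integrable (fun x => hermiteMatrix x i j * (v i * v j))
      ((stdGaussian (EuclideanSpace ℝ (Fin k))).restrict F) :=
    ((integrable_hermiteMatrix i j).mul_const _).integrableOn
  simp_rw [h1]
  rw [integral_finsetSum _ fun i _ => integrable_finsetSum _ fun j _ => hint i j]
  simp only [dotProduct, mulVec, Finset.mul_sum]
  refine Finset.sum_congr rfl fun i _ => ?_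
  rw [integral_finsetSum _ fun j _ => hint i j]
  refine Finset.sum_congr rfl fun j _ => ?_
  rw [integral_mul_const]
  simp only [momentDefect, of_apply]
  ring

theorem dotProduct_momentDefect_mulVec_eq (F : Set (EuclideanSpace ℝ (Fin k)))
    {v : EuclideanSpace ℝ (Fin k)} (hv : v ≠ 0) :
    v ⬝ᵥ momentDefect F *ᵥ v
      = ‖v‖ ^ 2 * ∫ x in F, (1 - ⟪‖v‖⁻¹ • v, x⟫ ^ 2) ∂(stdGaussian _) := by
  have hv' : ‖v‖ ≠ 0 := norm_ne_zero_iff.2 hv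
  rw [dotProduct_momentDefect_mulVec, ← integral_const_mul]
  refine integral_congr_ae (.of_forall fun x => ?_)
  simp only [real_inner_smul_left]
  field_simp

theorem momentDefect_posSemidef {F : Set (EuclideanSpace ℝ (Fin k))} (hF : MeasurableSet F)
    (hc : Convex ℝ F) (hs : ∀ x ∈ F, -x ∈ F) : (momentDefect F).PosSemidef := by
  refine PosSemidef.of_dotProduct_mulVec_nonneg ?_ fun x => ?_
  · ext i j
    simp only [conjTranspose_apply, star_trivial, momentDefect, of_apply, hermiteMatrix,
      Matrix.sub_apply, vecMulVec_apply]
    refine integral_congr_ae (.of_forall fun x => ?_)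
    simp only [one_apply, eq_comm (a := i), mul_comm]
  · set v : EuclideanSpace ℝ (Fin k) := WithLp.toLp 2 x with hv
    have e : star x = v.ofLp := rfl
    have e' : x = v.ofLp := rfl
    rw [e, e']
    by_cases h0 : v = 0
    · simp [h0]
    · rw [dotProduct_momentDefect_mulVec_eq F h0]
      refine mul_nonneg (by positivity) (setIntegral_one_sub_inner_sq_nonneg hF hc hs ?_)
      rw [norm_smul, norm_inv, norm_norm, inv_mul_cancel₀ (norm_ne_zero_iff.2 h0)]

/-- A closed symmetric convex set of positive measure is invariant under translation by the kernel
of its moment defect. -/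
theorem add_mem_of_momentDefect_mulVec_eq_zero {F : Set (EuclideanSpace ℝ (Fin k))}
    (hF : IsClosed F) (hc : Convex ℝ F) (hs : ∀ x ∈ F, -x ∈ F) (hpos : stdGaussian _ F ≠ 0)
    {v : EuclideanSpace ℝ (Fin k)} (hv : momentDefect F *ᵥ v = 0) {y : EuclideanSpace ℝ (Fin k)}
    (hy : y ∈ F) : y + v ∈ F := by
  by_cases h0 : v = 0
  · simpa [h0] using hy
  have hn : ‖v‖ ≠ 0 := norm_ne_zero_iff.2 h0
  have h1 := dotProduct_momentDefect_mulVec_eq F h0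
  rw [hv, dotProduct_zero] at h1
  have h2 := (mul_eq_zero.1 h1.symm).resolve_left (pow_ne_zero 2 hn)
  have h3 := add_smul_mem_of_setIntegral_eq_zero hF hc hs hpos
    (v := ‖v‖⁻¹ • v) (by rw [norm_smul, norm_inv, norm_norm, inv_mul_cancel₀ hn]) h2 hy ‖v‖
  rwa [smul_smul, mul_inv_cancel₀ hn, one_smul] at h3

end Hessian

/-! ### Coercivity off the degenerate directions -/

section Coercivity

variable {k : ℕ}

/-- Every square matrix has the same kernel as some idempotent matrix. -/
theorem exists_idempotent_same_ker (S : Matrix (Fin k) (Fin k) ℝ) :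
    ∃ P : Matrix (Fin k) (Fin k) ℝ, P * P = P ∧ ∀ v, P *ᵥ v = 0 ↔ S *ᵥ v = 0 := by
  obtain ⟨W, hW⟩ := (LinearMap.ker S.mulVecLin).exists_isCompl
  have hproj : W.projection _ hW.symm ∘ₗ W.projection _ hW.symm = W.projection _ hW.symm :=
    LinearMap.ext fun x => Submodule.projection_apply_of_mem_left hW.symm
      (Submodule.projection_apply_mem hW.symm x)
  refine ⟨LinearMap.toMatrix' (W.projection _ hW.symm), ?_, fun v => ?_⟩
  · rw [← LinearMap.toMatrix'_comp, hproj]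
  · rw [LinearMap.toMatrix'_mulVec, Submodule.projection_apply_eq_zero_iff, LinearMap.mem_ker,
      mulVecLin_apply]

theorem mul_eq_zero_iff_mulVec_col {M N : Matrix (Fin k) (Fin k) ℝ} :
    M * N = 0 ↔ ∀ j, M *ᵥ N.col j = 0 := by
  rw [← Matrix.ext_iff, forall_comm]
  simp only [funext_iff]
  rfl

theorem frobSq_smul (c : ℝ) (B : Matrix (Fin k) (Fin k) ℝ) : frobSq (c • B) = c ^ 2 * frobSq B := by
  simp [frobSq, mul_pow, Finset.mul_sum]

theorem frobSq_eq_zero {B : Matrix (Fin k) (Fin k) ℝ} : frobSq B = 0 ↔ B = 0 := by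
  rw [frobSq, Finset.sum_eq_zero_iff_of_nonneg fun i _ => by positivity]
  constructor
  · intro h
    ext i j
    have := (Finset.sum_eq_zero_iff_of_nonneg fun j _ => by positivity).1 (h i (Finset.mem_univ _))
      j (Finset.mem_univ _)
    simpa using this
  · rintro rfl
    simp

/-- The trace form of two positive semidefinite matrices is the squared Frobenius norm of
`√S * B * √T`. -/
theorem exists_trace_eq_frobSq {S T : Matrix (Fin k) (Fin k) ℝ} (hS : S.PosSemidef)
    (hT : T.PosSemidef) (B : Matrix (Fin k) (Fin k) ℝ) :
    ∃ R W : Matrix (Fin k) (Fin k) ℝ, S = R * R ∧ T = W * W ∧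
      (S * B * T * Bᵀ).trace = frobSq (R * B * W) := by
  have key {S : Matrix (Fin k) (Fin k) ℝ} (hS : S.PosSemidef) :
      CFC.sqrt S * CFC.sqrt S = S ∧ (CFC.sqrt S)ᵀ = CFC.sqrt S := by
    refine ⟨CFC.sqrt_mul_sqrt_self _ hS.nonneg, ?_⟩
    rw [← conjTranspose_eq_transpose_of_trivial]
    exact (CFC.sqrt_nonneg S).isSelfAdjoint
  refine ⟨CFC.sqrt S, CFC.sqrt T, (key hS).1.symm, (key hT).1.symm, ?_⟩
  rw [frobSq_eq_trace, transpose_mul, transpose_mul, (key hS).2, (key hT).2]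
  conv_lhs => rw [← (key hS).1, ← (key hT).1]
  simp only [Matrix.mul_assoc]
  rw [Matrix.trace_mul_comm]
  simp only [Matrix.mul_assoc]

theorem trace_mul_four_nonneg {S T : Matrix (Fin k) (Fin k) ℝ} (hS : S.PosSemidef)
    (hT : T.PosSemidef) (B : Matrix (Fin k) (Fin k) ℝ) : 0 ≤ (S * B * T * Bᵀ).trace := by
  obtain ⟨R, W, -, -, h⟩ := exists_trace_eq_frobSq hS hT B
  exact h ▸ frobSq_nonneg _

theorem mul_mul_eq_zero_of_trace_eq_zero {S T : Matrix (Fin k) (Fin k) ℝ} (hS : S.PosSemidef)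
    (hT : T.PosSemidef) {B : Matrix (Fin k) (Fin k) ℝ} (h0 : (S * B * T * Bᵀ).trace = 0) :
    S * B * T = 0 := by
  obtain ⟨R, W, hR, hW, h⟩ := exists_trace_eq_frobSq hS hT B
  have h1 : R * B * W = 0 := frobSq_eq_zero.1 (h ▸ h0)
  calc S * B * T = R * (R * B * W) * W := by rw [hR, hW]; simp only [Matrix.mul_assoc]
    _ = 0 := by rw [h1]; simp

/-- On the matrices with `P B Qᵀ = B` the trace form `tr(S B T Bᵀ)` vanishes only at `0`, so by
compactness of the unit sphere it dominates the Frobenius norm. -/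
theorem exists_coercive {S T P Q : Matrix (Fin k) (Fin k) ℝ} (hS : S.PosSemidef)
    (hT : T.PosSemidef) (hP : ∀ v, P *ᵥ v = 0 ↔ S *ᵥ v = 0) (hQ : ∀ v, Q *ᵥ v = 0 ↔ T *ᵥ v = 0) :
    ∃ c > 0, ∀ B, P * B * Qᵀ = B → c * frobSq B ≤ (S * B * T * Bᵀ).trace := by
  have hker {M N L : Matrix (Fin k) (Fin k) ℝ} (h : ∀ v, M *ᵥ v = 0 ↔ N *ᵥ v = 0)
      (hN : N * L = 0) : M * L = 0 :=
    mul_eq_zero_iff_mulVec_col.2 fun j => (h _).2 (mul_eq_zero_iff_mulVec_col.1 hN j)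
  have hTt : Tᵀ = T := by
    rw [← conjTranspose_eq_transpose_of_trivial]; exact hT.1
  have hzero (B : Matrix (Fin k) (Fin k) ℝ) (hB : P * B * Qᵀ = B)
      (h0 : (S * B * T * Bᵀ).trace = 0) : B = 0 := by
    have h1 := mul_mul_eq_zero_of_trace_eq_zero hS hT h0
    rw [Matrix.mul_assoc] at h1
    have h2 : P * (B * T) = 0 := hker hP h1
    -- The same kernel argument is applied on the other side, after transposing.
    have h3 : T * (P * B)ᵀ = 0 := by
      have := congrArg Matrix.transpose h2
      rw [← Matrix.mul_assoc, transpose_mul, hTt, transpose_zero] at this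
      exact this
    have h4 : Q * (P * B)ᵀ = 0 := hker hQ h3
    have h5 := congrArg Matrix.transpose h4
    rw [transpose_mul, transpose_transpose, transpose_zero, hB] at h5
    exact h5
  set K : Set (Matrix (Fin k) (Fin k) ℝ) := {B | frobSq B = 1 ∧ P * B * Qᵀ = B} with hK
  have hcont : Continuous fun B : Matrix (Fin k) (Fin k) ℝ => (S * B * T * Bᵀ).trace := by fun_prop
  have hcomp : IsCompact K := by
    have hbox : IsCompact (Set.univ.pi fun _ : Fin k => Set.univ.pi fun _ : Fin k =>
        Set.Icc (-1 : ℝ) 1) :=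
      isCompact_univ_pi fun _ => isCompact_univ_pi fun _ => isCompact_Icc
    refine hbox.of_isClosed_subset ?_ ?_
    · exact (isClosed_eq continuous_frobSq continuous_const).inter
        (isClosed_eq (by fun_prop) continuous_id)
    · rintro B ⟨hB, -⟩ i - j -
      have h1 : B i j ^ 2 ≤ frobSq B :=
        (Finset.single_le_sum (f := fun j => B i j ^ 2) (fun j _ => sq_nonneg _)
          (Finset.mem_univ j)).trans
          (Finset.single_le_sum (f := fun i => ∑ j, B i j ^ 2) (fun i _ => by positivity)
            (Finset.mem_univ i))
      exact abs_le.1 (abs_le_one_iff_mul_self_le_one.2 (by nlinarith))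
  have hmin : ∃ c > 0, ∀ B ∈ K, c ≤ (S * B * T * Bᵀ).trace := by
    rcases K.eq_empty_or_nonempty with he | hne
    · exact ⟨1, one_pos, by simp [he]⟩
    · obtain ⟨B₀, hB₀, hle⟩ := hcomp.exists_isMinOn hne hcont.continuousOn
      refine ⟨_, lt_of_le_of_ne (trace_mul_four_nonneg hS hT B₀) fun h => ?_, fun B hB => hle hB⟩
      have := hzero B₀ hB₀.2 h.symm
      have h1 := hB₀.1
      rw [frobSq_eq_zero.2 this] at h1
      exact zero_ne_one h1
  obtain ⟨c, hc, hcK⟩ := hmin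
  refine ⟨c, hc, fun B hB => ?_⟩
  rcases eq_or_ne (frobSq B) 0 with h0 | h0
  · rw [h0, mul_zero]
    exact trace_mul_four_nonneg hS hT B
  · have hpos : 0 < frobSq B := lt_of_le_of_ne (frobSq_nonneg B) h0.symm
    have hs2 : (√(frobSq B))⁻¹ ^ 2 * frobSq B = 1 := by
      rw [inv_pow, Real.sq_sqrt hpos.le, inv_mul_cancel₀ h0]
    have h1 := hcK ((√(frobSq B))⁻¹ • B) ⟨by rw [frobSq_smul, hs2], by simp [hB]⟩
    have h2 : (S * ((√(frobSq B))⁻¹ • B) * T * ((√(frobSq B))⁻¹ • B)ᵀ).trace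
        = (√(frobSq B))⁻¹ ^ 2 * (S * B * T * Bᵀ).trace := by
      simp [sq, mul_assoc]
    rw [h2] at h1
    calc c * frobSq B ≤ (√(frobSq B))⁻¹ ^ 2 * (S * B * T * Bᵀ).trace * frobSq B := by gcongr
      _ = (√(frobSq B))⁻¹ ^ 2 * frobSq B * (S * B * T * Bᵀ).trace := by ring
      _ = _ := by rw [hs2, one_mul]

end Coercivity

/-! ### The local minimum -/

section LocalMin

variable {k : ℕ}

/-- If `F` and `G` are invariant under translation by the kernels of the idempotents `P` and `Q`,
only the law of `(P X, Q Y)` matters, and its covariance depends on `B` through `P B Qᵀ`. -/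
theorem blockGaussian_compress {B P Q : Matrix (Fin k) (Fin k) ℝ} (hB : frobSq B < 1)
    (hB' : frobSq (P * B * Qᵀ) < 1) (hP : P * P = P) (hQ : Q * Q = Q)
    {F G : Set (EuclideanSpace ℝ (Fin k))} (hF : MeasurableSet F) (hG : MeasurableSet G)
    (hFP : toEuclideanCLM (𝕜 := ℝ) P ⁻¹' F = F) (hGQ : toEuclideanCLM (𝕜 := ℝ) Q ⁻¹' G = G) :
    blockGaussian 1 1 (P * B * Qᵀ) (prodSet F G) = blockGaussian 1 1 B (prodSet F G) := by
  have h1 := blockGaussian_conj_prodSet (posDef_fromBlocks_one hB).posSemidef P Q hF hG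
  have h2 := blockGaussian_conj_prodSet (posDef_fromBlocks_one hB').posSemidef P Q hF hG
  have e : P * (P * B * Qᵀ) * Qᵀ = P * B * Qᵀ := by
    calc P * (P * B * Qᵀ) * Qᵀ = (P * P) * B * (Q * Q)ᵀ := by
          rw [transpose_mul]; simp only [Matrix.mul_assoc]
      _ = P * B * Qᵀ := by rw [hP, hQ]
  rw [hFP, hGQ] at h1 h2
  rw [← h1, ← h2, e]

theorem preimage_eq_of_add_mem {F : Set (EuclideanSpace ℝ (Fin k))}
    {P : Matrix (Fin k) (Fin k) ℝ} (hP : P * P = P)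
    (h : ∀ v : EuclideanSpace ℝ (Fin k), P *ᵥ v = 0 → ∀ y ∈ F, y + v ∈ F) :
    toEuclideanCLM (𝕜 := ℝ) P ⁻¹' F = F := by
  ext x
  have h0 : P *ᵥ (x - toEuclideanCLM (𝕜 := ℝ) P x).ofLp = 0 := by
    rw [WithLp.ofLp_sub, ofLp_toEuclideanCLM, mulVec_sub, mulVec_mulVec, hP, sub_self]
  have h0' : P *ᵥ (toEuclideanCLM (𝕜 := ℝ) P x - x).ofLp = 0 := by
    rw [WithLp.ofLp_sub, ofLp_toEuclideanCLM, mulVec_sub, mulVec_mulVec, hP, sub_self]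
  constructor
  · intro hx
    simpa using h _ h0 _ hx
  · intro hx
    have := h _ h0' _ hx
    simpa using this

theorem blockGaussian_one_one_zero :
    blockGaussian (1 : Matrix (Fin k) (Fin k) ℝ) 1 0 = stdGaussian _ := by
  rw [blockGaussian, transpose_zero, fromBlocks_one, multivariateGaussian_zero_one]

theorem stdGaussian_prodSet {F G : Set (EuclideanSpace ℝ (Fin k))} (hF : MeasurableSet F)
    (hG : MeasurableSet G) :
    stdGaussian _ (prodSet F G) = stdGaussian _ F * stdGaussian _ G := by
  have hpre : joinCoords ⁻¹' prodSet F G = F ×ˢ G := by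
    ext p; exact joinCoords_mem_prodSet
  rw [← map_joinCoords_stdGaussian,
    Measure.map_apply continuous_joinCoords.measurable (measurableSet_prodSet hF hG), hpre,
    Measure.prod_prod]

theorem eventually_frobSq_lt {f : Matrix (Fin k) (Fin k) ℝ → Matrix (Fin k) (Fin k) ℝ}
    (hf : Continuous f) (hf0 : f 0 = 0) {ε : ℝ} (hε : 0 < ε) :
    ∀ᶠ B in 𝓝 0, frobSq (f B) < ε := by
  have h := (continuous_frobSq.comp hf).tendsto 0
  simp only [Function.comp_apply, hf0, frobSq_eq_zero.2 rfl] at h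
  exact h.eventually (gt_mem_nhds hε)

theorem isLocalMin_blockGaussian_one_one {F G : Set (EuclideanSpace ℝ (Fin k))}
    (hF : IsClosed F) (hFc : Convex ℝ F) (hFs : ∀ x ∈ F, -x ∈ F)
    (hG : IsClosed G) (hGc : Convex ℝ G) (hGs : ∀ x ∈ G, -x ∈ G) :
    IsLocalMin
      (fun B : Matrix (Fin k) (Fin k) ℝ => (blockGaussian 1 1 B).real (prodSet F G)) 0 := by
  have hFm := hF.measurableSet
  have hGm := hG.measurableSet
  -- If `F` or `G` is null, then so is `F × G` for `B = 0`; translation invariance may fail here.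
  by_cases h0 : stdGaussian _ F = 0 ∨ stdGaussian _ G = 0
  · refine .of_forall fun B => ?_
    have : (blockGaussian (1 : Matrix (Fin k) (Fin k) ℝ) 1 0).real (prodSet F G) = 0 := by
      rw [blockGaussian_one_one_zero, measureReal_def, stdGaussian_prodSet hFm hGm]
      rcases h0 with h | h <;> simp [h]
    simp only [this]
    exact measureReal_nonneg
  push Not at h0
  obtain ⟨P, hPP, hP⟩ := exists_idempotent_same_ker (momentDefect F)
  obtain ⟨Q, hQQ, hQ⟩ := exists_idempotent_same_ker (momentDefect G)
  have hFP : toEuclideanCLM (𝕜 := ℝ) P ⁻¹' F = F := preimage_eq_of_add_mem hPP fun v hv y hy =>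
    add_mem_of_momentDefect_mulVec_eq_zero hF hFc hFs h0.1 ((hP _).1 hv) hy
  have hGQ : toEuclideanCLM (𝕜 := ℝ) Q ⁻¹' G = G := preimage_eq_of_add_mem hQQ fun v hv y hy =>
    add_mem_of_momentDefect_mulVec_eq_zero hG hGc hGs h0.2 ((hQ _).1 hv) hy
  obtain ⟨c, hc, hcoer⟩ := exists_coercive (momentDefect_posSemidef hFm hFc hFs)
    (momentDefect_posSemidef hGm hGc hGs) hP hQ
  set M := ∫ z : EuclideanSpace ℝ (Fin k ⊕ Fin k), (1 + ‖z‖ ^ 2) ^ 3 ∂(stdGaussian _) with hM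
  have hM0 : 0 ≤ M := integral_nonneg fun z => by positivity
  have hcontPQ : Continuous fun B : Matrix (Fin k) (Fin k) ℝ => P * B * Qᵀ := by fun_prop
  -- The three bounds make `μ_B` nondegenerate, bring `P B Qᵀ` into the range of the expansion, and
  -- make the quartic error smaller than the coercive second-order term.
  filter_upwards [eventually_frobSq_lt continuous_id rfl one_pos,
    eventually_frobSq_lt hcontPQ (by simp) (show (0 : ℝ) < 1 / 4 by norm_num),
    eventually_frobSq_lt hcontPQ (by simp) (show 0 < c / (4 * (M + 1)) by positivity)]
    with B hB1 hB2 hB3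
  rw [id] at hB1
  rw [measureReal_def (blockGaussian 1 1 B),
    ← blockGaussian_compress hB1 (by linarith) hPP hQQ hFm hGm hFP hGQ, ← measureReal_def]
  have hB' : P * (P * B * Qᵀ) * Qᵀ = P * B * Qᵀ := by
    calc P * (P * B * Qᵀ) * Qᵀ = (P * P) * B * (Q * Q)ᵀ := by
          rw [transpose_mul]; simp only [Matrix.mul_assoc]
      _ = P * B * Qᵀ := by rw [hPP, hQQ]
  set B' := P * B * Qᵀ
  have h1 := le_blockGaussian_real_prodSet hB2.le hFm hGm hFs
  rw [setIntegral_quadDensity hFm hGm, ← hM] at h1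
  have h2 := hcoer B' hB'
  have h3 : 2 * frobSq B' ^ 2 * M ≤ c * frobSq B' / 2 := by
    have h4 := frobSq_nonneg B'
    rw [lt_div_iff₀ (by positivity)] at hB3
    nlinarith [mul_nonneg h4 hM0]
  rw [blockGaussian_one_one_zero]
  linarith

theorem convex_prodSet {F G : Set (EuclideanSpace ℝ (Fin k))} (hF : Convex ℝ F)
    (hG : Convex ℝ G) : Convex ℝ (prodSet F G) := fun _ hx _ hy _ _ ha hb hab =>
  ⟨hF hx.1 hy.1 ha hb hab, hG hx.2 hy.2 ha hb hab⟩

/-- Passing to closures changes a product of convex sets by a subset of its frontier, a null set. -/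
theorem measure_prodSet_closure {μ : Measure (EuclideanSpace ℝ (Fin k ⊕ Fin k))} (hμ : μ ≪ volume)
    {F G : Set (EuclideanSpace ℝ (Fin k))} (hF : Convex ℝ F) (hG : Convex ℝ G) :
    μ (prodSet (closure F) (closure G)) = μ (prodSet F G) := by
  have hsub : prodSet (closure F) (closure G) ⊆ closure (prodSet F G) := by
    intro z hz
    obtain ⟨p, rfl⟩ := exists_joinCoords_eq z
    rw [joinCoords_mem_prodSet, ← closure_prod_eq] at hz
    exact map_mem_closure continuous_joinCoords hz fun q hq => joinCoords_mem_prodSet.2 hq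
  have hsub' : prodSet F G ⊆ prodSet (closure F) (closure G) := fun z hz =>
    ⟨subset_closure hz.1, subset_closure hz.2⟩
  have hfr : μ (frontier (prodSet F G)) = 0 := hμ ((convex_prodSet hF hG).addHaar_frontier volume)
  refine le_antisymm ?_ (measure_mono hsub')
  calc μ (prodSet (closure F) (closure G)) ≤ μ (prodSet F G ∪ frontier (prodSet F G)) :=
        measure_mono (hsub.trans (closure_eq_self_union_frontier _).subset)
    _ ≤ μ (prodSet F G) + μ (frontier (prodSet F G)) := measure_union_le _ _
    _ = μ (prodSet F G) := by rw [hfr, add_zero]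

theorem exists_symm_invertible_sqrt {A : Matrix (Fin k) (Fin k) ℝ} (hA : A.PosDef) :
    ∃ a : Matrix (Fin k) (Fin k) ℝ, a * aᵀ = A ∧ IsUnit a.det := by
  have h1 : CFC.sqrt A * CFC.sqrt A = A := CFC.sqrt_mul_sqrt_self _ hA.posSemidef.nonneg
  refine ⟨CFC.sqrt A, ?_, ?_⟩
  · have : (CFC.sqrt A)ᵀ = CFC.sqrt A := by
      rw [← conjTranspose_eq_transpose_of_trivial]
      exact (CFC.sqrt_nonneg A).isSelfAdjoint
    rw [this, h1]
  · refine isUnit_iff_ne_zero.2 fun h => hA.det_pos.ne' ?_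
    rw [← h1, det_mul, h, zero_mul]

end LocalMin

theorem theorem2 (k : ℕ)
    (F G : Set (EuclideanSpace ℝ (Fin k)))
    (hF : Convex ℝ F) (hFsymm : ∀ x ∈ F, -x ∈ F)
    (hG : Convex ℝ G) (hGsymm : ∀ x ∈ G, -x ∈ G)
    (A C : Matrix (Fin k) (Fin k) ℝ) (hA : A.PosDef) (hC : C.PosDef) :
    IsLocalMin
      (fun B : Matrix (Fin k) (Fin k) ℝ => (blockGaussian A C B).real (prodSet F G)) 0 := by
  obtain ⟨a, haA, hau⟩ := exists_symm_invertible_sqrt hA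
  obtain ⟨c, hcC, hcu⟩ := exists_symm_invertible_sqrt hC
  -- The coordinates `x = a x'`, `y = c y'` turn the diagonal blocks into the identity and `B` into
  -- `a⁻¹ B (cᵀ)⁻¹`.
  have hclosure {H : Set (EuclideanSpace ℝ (Fin k))} (hH : ∀ x ∈ H, -x ∈ H) :
      ∀ x ∈ closure H, -x ∈ closure H := fun x hx => map_mem_closure continuous_neg hx hH
  set F' := toEuclideanCLM (𝕜 := ℝ) a ⁻¹' closure F with hF'
  set G' := toEuclideanCLM (𝕜 := ℝ) c ⁻¹' closure G with hG'
  have hmin : IsLocalMin (fun B : Matrix (Fin k) (Fin k) ℝ =>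
      (blockGaussian 1 1 B).real (prodSet F' G')) 0 :=
    isLocalMin_blockGaussian_one_one
      (isClosed_closure.preimage (toEuclideanCLM (𝕜 := ℝ) a).continuous)
      (hF.closure.linear_preimage (toEuclideanCLM (𝕜 := ℝ) a).toLinearMap)
      (fun x hx => by simpa [hF'] using hclosure hFsymm _ hx)
      (isClosed_closure.preimage (toEuclideanCLM (𝕜 := ℝ) c).continuous)
      (hG.closure.linear_preimage (toEuclideanCLM (𝕜 := ℝ) c).toLinearMap)
      (fun x hx => by simpa [hG'] using hclosure hGsymm _ hx)
  let f : Matrix (Fin k) (Fin k) ℝ → Matrix (Fin k) (Fin k) ℝ := fun B => a⁻¹ * B * (cᵀ)⁻¹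
  have hfc : Continuous f := by fun_prop
  have hf0 : f 0 = 0 := by simp [f]
  have hcu' : IsUnit cᵀ.det := by rwa [det_transpose]
  have hfB (B) : a * f B * cᵀ = B := by
    calc a * (a⁻¹ * B * (cᵀ)⁻¹) * cᵀ = (a * a⁻¹) * B * ((cᵀ)⁻¹ * cᵀ) := by
          simp only [Matrix.mul_assoc]
      _ = B := by rw [mul_nonsing_inv _ hau, nonsing_inv_mul _ hcu']; simp
  have htransfer (B) (hB : frobSq (f B) < 1) : (blockGaussian A C B).real (prodSet F G)
      = (blockGaussian 1 1 (f B)).real (prodSet F' G') := by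
    have hpd := posDef_fromBlocks_one hB
    have e : fromBlocks A B Bᵀ C
        = fromBlocks a 0 0 c * fromBlocks 1 (f B) (f B)ᵀ 1 * (fromBlocks a 0 0 c)ᴴ := by
      rw [conjTranspose_eq_transpose_of_trivial]
      have h2 : Bᵀ = c * ((f B)ᵀ * aᵀ) := by
        conv_lhs => rw [← hfB B]
        simp [Matrix.mul_assoc]
      simp [fromBlocks_multiply, fromBlocks_transpose, haA, hcC, hfB, h2, Matrix.mul_assoc]
    have hu : IsUnit (fromBlocks a 0 0 c) := by
      rw [isUnit_iff_isUnit_det, det_fromBlocks_zero₂₁]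
      exact hau.mul hcu
    have hpd' : (fromBlocks A B Bᵀ C).PosDef := by
      rw [e]
      exact hpd.mul_mul_conjTranspose_same (vecMul_injective_of_isUnit hu)
    have hac : blockGaussian A C B ≪ volume := multivariateGaussian_absolutelyContinuous hpd'
    have h := blockGaussian_conj_prodSet hpd.posSemidef a c
      (isClosed_closure (s := F)).measurableSet (isClosed_closure (s := G)).measurableSet
    rw [Matrix.mul_one, Matrix.mul_one, haA, hcC, hfB] at h
    rw [measureReal_def, measureReal_def, ← measure_prodSet_closure hac hF hG, h]
  have hcomp : ∀ᶠ B in 𝓝 (0 : Matrix (Fin k) (Fin k) ℝ),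
      (blockGaussian 1 1 0).real (prodSet F' G')
        ≤ (blockGaussian 1 1 (f B)).real (prodSet F' G') := by
    have ht : Tendsto f (𝓝 0) (𝓝 0) := by simpa [hf0] using hfc.tendsto 0
    exact ht.eventually hmin
  filter_upwards [hcomp, eventually_frobSq_lt hfc hf0 one_pos] with B hB1 hB2
  rw [htransfer B hB2, htransfer 0 (by rw [hf0, frobSq_eq_zero.2 rfl]; exact one_pos), hf0]
  exact hB1
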